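/- Let $N\ge 1$ and let $\Omega\subset\mathbb R^N$ be a nonempty bounded open set. Put $k(z)=\mathbf 1_{B_1}(z)|z|^{-N}$, $j(z)=\mathbf 1_{\mathbb R^N\setminus B_1}(z)|z|^{-N}$, $c_N=\pi^{-N/2}\Gamma(N/2)$ and $\rho_N=2\ln 2+\psi(N/2)-\gamma$, where $B_1$ is the open Euclidean unit ball, $\psi=\Gamma'/\Gamma$ and $\gamma$ is the Euler–Mascheroni constant. Let $$\mathbb H(\Omega)=\Big\{u\in L^2(\mathbb R^N): u=0 \text{ a.e. in }\mathbb R^N\setminus\Omega,\ \iint_{\mathbb R^{2N}}|u(x)-u(y)|^2k(x-y)\,dx\,dy<\infty\Big\},$$ with inner product $\mathcal E(u,v)=\frac{c_N}{2}\iint (u(x)-u(y))(v(x)-v(y))k(x-y)\,dx\,dy$ and norm $\|u\|=\mathcal E(u,u)^{1/2}$, and let $$\mathcal E_L(u,v)=\mathcal E(u,v)-c_N\iint_{\mathbb R^{2N}}u(x)v(y)j(x-y)\,dx\,dy+\rho_N\int_{\mathbb R^N} uv\,dx$$ be the quadratic form of the logarithmic Laplacian $L_\Delta$. Write $u^\pm=\max\{\pm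 u,0\}$. The Fučík spectrum $\Sigma_L$ is the set of all $(\alpha,\beta)\in\mathbb R^2$ for which there is $u\in\mathbb H(\Omega)$, $u\ne 0$, with $$\mathcal E_L(u,v)=\alpha\int_\Omega u^+v\,dx-\beta\int_\Omega u^-v\,dx\qquad\text{for all }v\in\mathbb H(\Omega).$$ Let $I(u)=\int_\Omega u^2\,dx$, $\mathcal P=\{u\in\mathbb H(\Omega): I(u)=1\}$ and $\lambda_1^L=\inf_{u\in\mathcal P}\mathcal E_L(u,u)$. For $r\ge 0$ let $E_r(u)=\mathcal E_L(u,u)-r\int_\Omega(u^+)^2\,dx$ on $\mathbb H(\Omega)$, and let $\tilde E_r$ be the restriction of $E_r$ to $\mathcal P$; $u\in\mathcal P$ is a critical point of $\tilde E_r$ if $E_r$ and $I$ are Fréchet differentiable at $u$ and $E_r'(u)=t\,I'(u)$ for some $t\in\mathbb R$. A normalized first eigenfunction is a function $\varphi_1\in\mathcal P$ with $\varphi_1\ge 0$ a.e. and $\mathcal E_L(\varphi_1,v)=\lambda_1^L\int_\Omega\varphi_1v\,dx$ for all $v\in\mathbb H(\Omega)$. Such a $\varphi_1$ exists, and for every such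 $\varphi_1$ and every $r\ge 0$: - $\varphi_1$ is a critical point of $\tilde E_r$; - (i) $\varphi_1$ is a global minimum of $\tilde E_r$ on $\mathcal P$; - (ii) $\tilde E_r(\varphi_1)=\lambda_1^L-r$; - $(\lambda_1^L,\lambda_1^L-r)\in\Sigma_L$. Moreover the whole vertical line lies in the spectrum: $(\lambda_1^L,\beta)\in\Sigma_L$ for every $\beta\in\mathbb R$. -/

import Mathlib

open MeasureTheory Set

noncomputable section

namespace LogLaplacian

/-- `ℝ^N` with its Euclidean norm. -/
abbrev Space (N : ℕ) : Type := EuclideanSpace ℝ (Fin N)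

variable {N : ℕ}

/-- The constant `c_N = π^{-N/2} Γ(N/2)`. -/
def cConst (N : ℕ) : ℝ := Real.pi ^ (-(N : ℝ) / 2) * Real.Gamma ((N : ℝ) / 2)

/-- The constant `ρ_N = 2 ln 2 + ψ(N/2) - γ`, where `ψ = Γ'/Γ`. -/
def rhoConst (N : ℕ) : ℝ :=
  2 * Real.log 2 + logDeriv Real.Gamma ((N : ℝ) / 2) - Real.eulerMascheroniConstant

/-- The short range kernel `k(z) = 1_{B_1}(z) / |z|^N`. -/
def kKer (z : Space N) : ℝ :=
  (Metric.ball (0 : Space N) 1).indicator (fun w => 1 / ‖w‖ ^ N) z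

/-- The long range kernel `j(z) = 1_{ℝ^N \ B_1}(z) / |z|^N`. -/
def jKer (z : Space N) : ℝ :=
  ((Metric.ball (0 : Space N) 1)ᶜ).indicator (fun w => 1 / ‖w‖ ^ N) z

lemma kKer_nonneg (z : Space N) : 0 ≤ kKer z :=
  Set.indicator_nonneg (fun _ _ => by positivity) z

lemma measurable_kKer : Measurable (kKer : Space N → ℝ) := by
  unfold kKer
  exact Measurable.indicator (by fun_prop) measurableSet_ball

/-- The integrand `(u(x) - u(y)) (v(x) - v(y)) k(x - y)` of the form `𝓔`. -/
def formIntegrand (u v : Space N → ℝ) (p : Space N × Space N) : ℝ :=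
  (u p.1 - u p.2) * (v p.1 - v p.2) * kKer (p.1 - p.2)

lemma aestronglyMeasurable_formIntegrand {u v : Space N → ℝ}
    (hu : AEStronglyMeasurable u volume) (hv : AEStronglyMeasurable v volume) :
    AEStronglyMeasurable (formIntegrand u v) (volume.prod volume) := by
  unfold formIntegrand
  refine ((hu.comp_fst.sub hu.comp_snd).mul (hv.comp_fst.sub hv.comp_snd)).mul ?_
  exact (measurable_kKer.comp (measurable_fst.sub measurable_snd)).aestronglyMeasurable

lemma formIntegrand_congr {u u' v v' : Space N → ℝ}
    (hu : u =ᵐ[volume] u') (hv : v =ᵐ[volume] v') :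
    formIntegrand u v =ᵐ[volume.prod volume] formIntegrand u' v' := by
  have h1 := Measure.quasiMeasurePreserving_fst (μ := (volume : Measure (Space N)))
    (ν := (volume : Measure (Space N)))
  have h2 := Measure.quasiMeasurePreserving_snd (μ := (volume : Measure (Space N)))
    (ν := (volume : Measure (Space N)))
  filter_upwards [h1.ae hu, h2.ae hu, h1.ae hv, h2.ae hv] with p a b c d
  simp only [formIntegrand, a, b, c, d]

lemma integrable_formIntegrand {u v : Space N → ℝ}
    (hum : AEStronglyMeasurable u volume) (hvm : AEStronglyMeasurable v volume)
    (hu : Integrable (formIntegrand u u) (volume.prod volume))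
    (hv : Integrable (formIntegrand v v) (volume.prod volume)) :
    Integrable (formIntegrand u v) (volume.prod volume) := by
  refine (hu.add hv).mono' (aestronglyMeasurable_formIntegrand hum hvm)
    (Filter.Eventually.of_forall fun p => ?_)
  have hk := kKer_nonneg (p.1 - p.2)
  simp only [formIntegrand, Pi.add_apply, Real.norm_eq_abs, abs_mul, abs_of_nonneg hk]
  rw [← add_mul]
  gcongr
  rw [← abs_mul, abs_le]
  constructor <;>
    nlinarith [sq_nonneg (u p.1 - u p.2 + (v p.1 - v p.2)),
      sq_nonneg (u p.1 - u p.2 - (v p.1 - v p.2)),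
      sq_nonneg (u p.1 - u p.2), sq_nonneg (v p.1 - v p.2)]

/-- The linear subspace of `L²(ℝ^N)` underlying the energy space `ℍ(Ω)`: the functions that vanish
(a.e.) outside `Ω` and satisfy `∬ |u(x) - u(y)|² k(x - y) dx dy < ∞`. -/
def energySubmodule (Ω : Set (Space N)) : Submodule ℝ (Lp ℝ 2 (volume : Measure (Space N))) where
  carrier := {u | (∀ᵐ x ∂volume, x ∉ Ω → u x = 0) ∧
    Integrable (formIntegrand u u) (volume.prod volume)}
  zero_mem' := by
    have h0 := Lp.coeFn_zero ℝ 2 (volume : Measure (Space N))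
    refine ⟨?_, ?_⟩
    · filter_upwards [h0] with x hx _ using hx
    · rw [integrable_congr (formIntegrand_congr h0 h0)]
      have : formIntegrand (0 : Space N → ℝ) 0 = 0 := by
        funext p; simp [formIntegrand]
      rw [this]
      exact integrable_zero _ _ _
  add_mem' := by
    rintro u v ⟨hu, hu'⟩ ⟨hv, hv'⟩
    have ha := Lp.coeFn_add u v
    have hum := Lp.aestronglyMeasurable u
    have hvm := Lp.aestronglyMeasurable v
    refine ⟨?_, ?_⟩
    · filter_upwards [hu, hv, ha] with x h1 h2 h3 hx
      rw [h3, Pi.add_apply, h1 hx, h2 hx, add_zero]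
    · rw [integrable_congr (formIntegrand_congr ha ha)]
      have huv := integrable_formIntegrand hum hvm hu' hv'
      refine ((hu'.add (huv.const_mul 2)).add hv').congr
        (Filter.Eventually.of_forall fun p => ?_)
      simp only [formIntegrand, Pi.add_apply]
      ring
  smul_mem' := by
    rintro c u ⟨hu, hu'⟩
    have ha := Lp.coeFn_smul c u
    refine ⟨?_, ?_⟩
    · filter_upwards [hu, ha] with x h1 h3 hx
      rw [h3, Pi.smul_apply, h1 hx, smul_zero]
    · rw [integrable_congr (formIntegrand_congr ha ha)]
      refine (hu'.const_mul (c * c)).congr (Filter.Eventually.of_forall fun p => ?_)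
      simp only [formIntegrand, Pi.smul_apply, smul_eq_mul]
      ring

/-- The energy space `ℍ(Ω)`. It is a type of its own because it carries the norm of `𝓔`
and not the norm inherited from `L²`. -/
def EnergySpace (Ω : Set (Space N)) : Type := ↥(energySubmodule Ω)

variable {Ω : Set (Space N)}

instance : AddCommGroup (EnergySpace Ω) := inferInstanceAs (AddCommGroup ↥(energySubmodule Ω))

instance : Module ℝ (EnergySpace Ω) := inferInstanceAs (Module ℝ ↥(energySubmodule Ω))

/-- The `L²` class of an element of `ℍ(Ω)`. -/
def EnergySpace.toLp (u : EnergySpace Ω) : Lp ℝ 2 (volume : Measure (Space N)) := u.1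

/-- An element of `ℍ(Ω)` as a function on `ℝ^N`. -/
instance : CoeFun (EnergySpace Ω) (fun _ => Space N → ℝ) := ⟨fun u => (u.toLp : Space N → ℝ)⟩

lemma EnergySpace.integrable (u v : EnergySpace Ω) :
    Integrable (formIntegrand u v) (volume.prod volume) :=
  integrable_formIntegrand (Lp.aestronglyMeasurable _) (Lp.aestronglyMeasurable _) u.2.2 v.2.2

/-- The inner product
`𝓔(u,v) = (c_N / 2) ∬ (u(x) - u(y)) (v(x) - v(y)) k(x - y) dx dy` of `ℍ(Ω)`. -/
def form (u v : EnergySpace Ω) : ℝ :=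
  cConst N / 2 * ∫ p, formIntegrand u v p ∂(volume.prod volume)

lemma cConst_nonneg (N : ℕ) : 0 ≤ cConst N :=
  mul_nonneg (Real.rpow_nonneg Real.pi_pos.le _) (Real.Gamma_nonneg_of_nonneg (by positivity))

/-- `𝓔` is a positive semidefinite symmetric bilinear form. -/
@[reducible] def formCore (Ω : Set (Space N)) : PreInnerProductSpace.Core ℝ (EnergySpace Ω) where
  inner u v := form u v
  conj_inner_symm u v := by
    simp only [form, formIntegrand, conj_trivial]
    congr 2
    funext p
    ring
  re_inner_nonneg u := by
    simp only [form, RCLike.re_to_real]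
    refine mul_nonneg (div_nonneg (cConst_nonneg N) two_pos.le) (integral_nonneg fun p => ?_)
    exact mul_nonneg (mul_self_nonneg _) (kKer_nonneg _)
  add_left u v w := by
    have h : formIntegrand (u + v : EnergySpace Ω) w =ᵐ[volume.prod volume]
        fun p => formIntegrand u w p + formIntegrand v w p := by
      refine (formIntegrand_congr (Lp.coeFn_add u.toLp v.toLp) (ae_eq_refl _)).trans
        (Filter.Eventually.of_forall fun p => ?_)
      simp only [formIntegrand, Pi.add_apply]
      ring
    simp only [form]
    rw [integral_congr_ae h, integral_add (u.integrable w) (v.integrable w), mul_add]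
  smul_left u v c := by
    have h : formIntegrand (c • u : EnergySpace Ω) v =ᵐ[volume.prod volume]
        fun p => c * formIntegrand u v p := by
      refine (formIntegrand_congr (Lp.coeFn_smul c u.toLp) (ae_eq_refl _)).trans
        (Filter.Eventually.of_forall fun p => ?_)
      simp only [formIntegrand, Pi.smul_apply, smul_eq_mul]
      ring
    simp only [form, conj_trivial]
    rw [integral_congr_ae h, integral_const_mul]
    ring

/-- The norm `‖u‖ = 𝓔(u,u)^{1/2}` of `ℍ(Ω)`. (For `N ≥ 1` it is definite, since `𝓔(u,u) = 0` forces
`u` to be a constant in `L²(ℝ^N)`; the instance does not record this.) -/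
instance : SeminormedAddCommGroup (EnergySpace Ω) :=
  @InnerProductSpace.Core.toSeminormedAddCommGroup ℝ (EnergySpace Ω) _ _ _ (formCore Ω)

instance : InnerProductSpace ℝ (EnergySpace Ω) := InnerProductSpace.ofCore (formCore Ω)

/-- The quadratic form of the logarithmic Laplacian,
`𝓔_L(u,v) = 𝓔(u,v) - c_N ∬ u(x) v(y) j(x - y) dx dy + ρ_N ∫ u v dx`. -/
def formL (u v : EnergySpace Ω) : ℝ :=
  form u v
    - cConst N * ∫ p : Space N × Space N, u p.1 * v p.2 * jKer (p.1 - p.2) ∂(volume.prod volume)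
    + rhoConst N * ∫ x, u x * v x

/-- `I(u) = ∫_Ω u²`. -/
def massI (u : EnergySpace Ω) : ℝ := ∫ x in Ω, u x ^ 2

/-- The `L²` unit sphere `𝓟` of `ℍ(Ω)`. -/
def unitSphere (Ω : Set (Space N)) : Set (EnergySpace Ω) := {u | massI u = 1}

/-- The first eigenvalue `λ₁^L = inf {𝓔_L(u,u) : u ∈ ℍ(Ω), ‖u‖₂ = 1}`. -/
def firstEigenvalue (Ω : Set (Space N)) : ℝ :=
  sInf ((fun u : EnergySpace Ω => formL u u) '' unitSphere Ω)

/-- `u` is a weak solution of `L_Δ u = α u⁺ - β u⁻` in `Ω`, `u = 0` in `ℝ^N \ Ω`. -/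
def IsWeakSolution (α β : ℝ) (u : EnergySpace Ω) : Prop :=
  ∀ v : EnergySpace Ω,
    formL u v = α * (∫ x in Ω, max (u x) 0 * v x) - β * (∫ x in Ω, max (-u x) 0 * v x)

/-- The Fučík spectrum `Σ_L`: the pairs `(α, β)` for which a nontrivial weak solution exists. -/
def fucikSpectrum (Ω : Set (Space N)) : Set (ℝ × ℝ) :=
  {p | ∃ u : EnergySpace Ω, u ≠ 0 ∧ IsWeakSolution p.1 p.2 u}

/-- `φ` is a nonnegative, `L²`-normalized eigenfunction (in the weak sense) of `L_Δ` for the first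
eigenvalue. -/
structure IsFirstEigenfunction (φ : EnergySpace Ω) : Prop where
  nonneg : ∀ᵐ x ∂volume, 0 ≤ φ x
  mem_unitSphere : φ ∈ unitSphere Ω
  eigen : ∀ v : EnergySpace Ω, formL φ v = firstEigenvalue Ω * ∫ x in Ω, φ x * v x

/-- The functional `E_r(u) = 𝓔_L(u,u) - r ∫_Ω (u⁺)²`; its restriction to `𝓟` is `Ẽ_r`. -/
def energy (r : ℝ) (u : EnergySpace Ω) : ℝ :=
  formL u u - r * ∫ x in Ω, (max (u x) 0) ^ 2

/-- `u` is a critical point of `Ẽ_r`, the restriction of `E_r` to `𝓟`: `u ∈ 𝓟` and there is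
a Lagrange multiplier `t` with `E_r'(u) = t I'(u)`, where the derivatives are Fréchet derivatives
on `ℍ(Ω)`. -/
def IsCriticalPoint (r : ℝ) (u : EnergySpace Ω) : Prop :=
  u ∈ unitSphere Ω ∧ ∃ (t : ℝ) (E' I' : EnergySpace Ω →L[ℝ] ℝ),
    HasFDerivAt (energy r) E' u ∧ HasFDerivAt massI I' u ∧ E' = t • I'

end LogLaplacian

end

open MeasureTheory Set

noncomputable section

namespace LogLaplacian

variable {N : ℕ} {Ω : Set (Space N)}

/-- The bilinear form `∬ u(x) v(y) K(x - y) dx dy`. -/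
def kerForm (K u v : Space N → ℝ) : ℝ :=
  ∫ p : Space N × Space N, u p.1 * v p.2 * K (p.1 - p.2) ∂(volume.prod volume)

lemma integrable_kerForm {K u v : Space N → ℝ} {C : ℝ} (hK : Measurable K) (hC : ∀ z, |K z| ≤ C)
    (hu : Integrable u) (hv : Integrable v) :
    Integrable (fun p : Space N × Space N => u p.1 * v p.2 * K (p.1 - p.2))
      (volume.prod volume) :=
  (hu.mul_prod hv).mul_bdd (c := C)
    (hK.comp (measurable_fst.sub measurable_snd)).aestronglyMeasurable
    (Filter.Eventually.of_forall fun _ => hC _)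

lemma ae_prod_of_ae {u u' v v' : Space N → ℝ} (hu : u =ᵐ[volume] u') (hv : v =ᵐ[volume] v') :
    ∀ᵐ p : Space N × Space N ∂(volume.prod volume), u p.1 = u' p.1 ∧ v p.2 = v' p.2 := by
  have h1 := Measure.quasiMeasurePreserving_fst (μ := (volume : Measure (Space N)))
    (ν := (volume : Measure (Space N)))
  have h2 := Measure.quasiMeasurePreserving_snd (μ := (volume : Measure (Space N)))
    (ν := (volume : Measure (Space N)))
  filter_upwards [h1.ae hu, h2.ae hv] with p a b using ⟨a, b⟩

lemma kerForm_congr {K u u' v v' : Space N → ℝ} (hu : u =ᵐ[volume] u') (hv : v =ᵐ[volume] v') :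
    kerForm K u v = kerForm K u' v' := by
  refine integral_congr_ae ?_
  filter_upwards [ae_prod_of_ae hu hv] with p hp
  rw [hp.1, hp.2]

lemma abs_kerForm_le {K u v : Space N → ℝ} {C : ℝ} (hK : Measurable K) (hC : ∀ z, |K z| ≤ C)
    (hu : Integrable u) (hv : Integrable v) :
    |kerForm K u v| ≤ C * ((∫ x, |u x|) * ∫ x, |v x|) := by
  refine (abs_integral_le_integral_abs).trans ?_
  rw [← integral_prod_mul, ← integral_const_mul]
  refine integral_mono (integrable_kerForm hK hC hu hv).abs
    ((hu.abs.mul_prod hv.abs).const_mul C) fun p => ?_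
  simp only [abs_mul]
  rw [mul_comm C]
  exact mul_le_mul_of_nonneg_left (hC _) (by positivity)

lemma kerForm_comm {K : Space N → ℝ} (hK : ∀ z, K (-z) = K z) (u v : Space N → ℝ) :
    kerForm K u v = kerForm K v u := by
  unfold kerForm
  rw [← integral_prod_swap]
  refine integral_congr_ae (Filter.Eventually.of_forall fun p => ?_)
  simp only [Prod.fst_swap, Prod.snd_swap]
  rw [← hK (p.1 - p.2), neg_sub, mul_comm (u p.2)]

namespace EnergySpace

lemma ae_eq_zero_of_notMem (u : EnergySpace Ω) : ∀ᵐ x, x ∉ Ω → u x = 0 := u.2.1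

lemma coe_add (u v : EnergySpace Ω) : (u + v : EnergySpace Ω) =ᵐ[volume] fun x => u x + v x :=
  Lp.coeFn_add u.toLp v.toLp

lemma coe_sub (u v : EnergySpace Ω) : (u - v : EnergySpace Ω) =ᵐ[volume] fun x => u x - v x :=
  Lp.coeFn_sub u.toLp v.toLp

lemma coe_smul (c : ℝ) (u : EnergySpace Ω) :
    (c • u : EnergySpace Ω) =ᵐ[volume] fun x => c * u x :=
  Lp.coeFn_smul c u.toLp

lemma measurable (u : EnergySpace Ω) : Measurable (u : Space N → ℝ) :=
  (Lp.stronglyMeasurable u.toLp).measurable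

lemma memLp (u : EnergySpace Ω) : MemLp (u : Space N → ℝ) 2 := Lp.memLp u.toLp

lemma integrable_mul (u v : EnergySpace Ω) : Integrable fun x => u x * v x :=
  u.memLp.integrable_mul v.memLp

lemma integrable_sq (u : EnergySpace Ω) : Integrable fun x => u x ^ 2 := u.memLp.integrable_sq

lemma setIntegral_mul_eq (f : Space N → ℝ) (v : EnergySpace Ω) :
    ∫ x in Ω, f x * v x = ∫ x, f x * v x := by
  refine setIntegral_eq_integral_of_ae_compl_eq_zero ?_
  filter_upwards [v.ae_eq_zero_of_notMem] with x hx h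
  rw [hx h, mul_zero]

lemma inner_toLp (u v : EnergySpace Ω) : inner ℝ u.toLp v.toLp = ∫ x, u x * v x := by
  rw [L2.inner_def]
  exact integral_congr_ae (Filter.Eventually.of_forall fun x => by simp [mul_comm])

lemma norm_toLp_sq (u : EnergySpace Ω) : ‖u.toLp‖ ^ 2 = ∫ x, u x ^ 2 := by
  rw [← real_inner_self_eq_norm_sq, inner_toLp]
  simp only [sq]

lemma massI_eq_integral (u : EnergySpace Ω) : massI u = ∫ x, u x ^ 2 := by
  simp only [massI, sq]
  exact setIntegral_mul_eq _ _

lemma massI_eq (u : EnergySpace Ω) : massI u = ‖u.toLp‖ ^ 2 := by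
  rw [norm_toLp_sq, massI_eq_integral]

lemma integrable_coe (hΩ : Bornology.IsBounded Ω) (hm : MeasurableSet Ω) (u : EnergySpace Ω) :
    Integrable (u : Space N → ℝ) := by
  have : Fact (volume Ω < ⊤) := ⟨hΩ.measure_lt_top⟩
  have h : IntegrableOn (u : Space N → ℝ) Ω :=
    (u.memLp.restrict Ω).integrable (by norm_num)
  refine (integrable_indicator_iff hm).2 h |>.congr ?_
  filter_upwards [u.ae_eq_zero_of_notMem] with x hx
  by_cases hxΩ : x ∈ Ω
  · simp [hxΩ]
  · simp [hxΩ, hx hxΩ]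

lemma integral_abs_le (hΩ : Bornology.IsBounded Ω) (hm : MeasurableSet Ω) (u : EnergySpace Ω) :
    ∫ x, |u x| ≤ √(volume.real Ω) * ‖u.toLp‖ := by
  have h1 : ∫ x, |u x| = inner ℝ (indicatorConstLp 2 hm hΩ.measure_lt_top.ne (1 : ℝ)) |u.toLp| := by
    rw [L2.inner_indicatorConstLp_one,
      setIntegral_eq_integral_of_ae_compl_eq_zero]
    · exact integral_congr_ae (Lp.coeFn_abs u.toLp).symm
    · filter_upwards [u.ae_eq_zero_of_notMem, Lp.coeFn_abs u.toLp] with x hx h h'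
      rw [h, hx h', abs_zero]
  rw [h1]
  refine (real_inner_le_norm _ _).trans (le_of_eq ?_)
  rw [norm_indicatorConstLp (by norm_num) (by norm_num), norm_abs_eq_norm]
  simp [Real.sqrt_eq_rpow]

end EnergySpace

lemma abs_kerForm_le_norm (hΩ : Bornology.IsBounded Ω) (hm : MeasurableSet Ω) {K : Space N → ℝ}
    {C : ℝ} (hK : Measurable K) (hC : ∀ z, |K z| ≤ C) (u v : EnergySpace Ω) :
    |kerForm K u v| ≤ C * volume.real Ω * (‖u.toLp‖ * ‖v.toLp‖) := by
  have hC0 : 0 ≤ C := (abs_nonneg _).trans (hC 0)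
  refine (abs_kerForm_le hK hC (u.integrable_coe hΩ hm) (v.integrable_coe hΩ hm)).trans ?_
  calc C * ((∫ x, |u x|) * ∫ x, |v x|)
      ≤ C * ((√(volume.real Ω) * ‖u.toLp‖) * (√(volume.real Ω) * ‖v.toLp‖)) := by
        have h1 := u.integral_abs_le hΩ hm
        have h2 := v.integral_abs_le hΩ hm
        have h3 : 0 ≤ ∫ x, |v x| := integral_nonneg fun _ => abs_nonneg _
        gcongr
    _ = C * (√(volume.real Ω) * √(volume.real Ω)) * (‖u.toLp‖ * ‖v.toLp‖) := by ring
    _ = _ := by rw [Real.mul_self_sqrt measureReal_nonneg]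

lemma kerForm_add_left (hΩ : Bornology.IsBounded Ω) (hm : MeasurableSet Ω) {K : Space N → ℝ}
    {C : ℝ} (hK : Measurable K) (hC : ∀ z, |K z| ≤ C) (u v w : EnergySpace Ω) :
    kerForm K (u + v : EnergySpace Ω) w = kerForm K u w + kerForm K v w := by
  have hi (a b : EnergySpace Ω) := integrable_kerForm hK hC (a.integrable_coe hΩ hm)
    (b.integrable_coe hΩ hm)
  rw [kerForm_congr (u.coe_add v) (ae_eq_refl _)]
  unfold kerForm
  rw [← integral_add (hi u w) (hi v w)]
  refine integral_congr_ae (Filter.Eventually.of_forall fun p => ?_)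
  simp only
  ring

lemma kerForm_smul_left (K : Space N → ℝ) (c : ℝ) (u v : EnergySpace Ω) :
    kerForm K (c • u : EnergySpace Ω) v = c * kerForm K u v := by
  rw [kerForm_congr (u.coe_smul c) (ae_eq_refl _)]
  unfold kerForm
  rw [← integral_const_mul]
  refine integral_congr_ae (Filter.Eventually.of_forall fun p => ?_)
  simp only
  ring

lemma kKer_neg (z : Space N) : kKer (-z) = kKer z := by
  simp [kKer, Set.indicator]

lemma jKer_neg (z : Space N) : jKer (-z) = jKer z := by
  simp [jKer, Set.indicator]

lemma measurable_jKer : Measurable (jKer : Space N → ℝ) := by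
  unfold jKer
  exact Measurable.indicator (by fun_prop) measurableSet_ball.compl

lemma jKer_nonneg (z : Space N) : 0 ≤ jKer z :=
  Set.indicator_nonneg (fun _ _ => by positivity) z

lemma abs_jKer_le_one (z : Space N) : |jKer z| ≤ 1 := by
  rw [abs_of_nonneg (jKer_nonneg z)]
  refine Set.indicator_apply_le' (fun h => ?_) fun _ => zero_le_one
  have h1 : 1 ≤ ‖z‖ := by simpa using h
  rw [div_le_one (by positivity)]
  exact one_le_pow₀ h1

lemma form_eq_inner (u v : EnergySpace Ω) : form u v = inner ℝ u v := rfl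

lemma form_self_eq (u : EnergySpace Ω) : form u u = ‖u‖ ^ 2 := by
  rw [form_eq_inner, real_inner_self_eq_norm_sq]

lemma formL_eq (u v : EnergySpace Ω) :
    formL u v = inner ℝ u v - cConst N * kerForm jKer u v
      + rhoConst N * inner ℝ u.toLp v.toLp := by
  rw [EnergySpace.inner_toLp]; rfl

lemma formL_comm (u v : EnergySpace Ω) : formL u v = formL v u := by
  simp only [formL_eq]
  rw [kerForm_comm jKer_neg, real_inner_comm, real_inner_comm u.toLp]

lemma formL_add_left (hΩ : Bornology.IsBounded Ω) (hm : MeasurableSet Ω) (u v w : EnergySpace Ω) :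
    formL (u + v) w = formL u w + formL v w := by
  simp only [formL_eq]
  rw [kerForm_add_left hΩ hm measurable_jKer abs_jKer_le_one, inner_add_left,
    show (u + v).toLp = u.toLp + v.toLp from rfl, inner_add_left]
  ring

lemma formL_smul_left (c : ℝ) (u v : EnergySpace Ω) : formL (c • u) v = c * formL u v := by
  simp only [formL_eq]
  rw [kerForm_smul_left, real_inner_smul_left,
    show (c • u).toLp = c • u.toLp from rfl, real_inner_smul_left]
  ring

/-- `𝓔_L - t ⟨·,·⟩_{L²}` as a bilinear form on `ℍ(Ω)`. -/
def shiftedForm (hΩ : Bornology.IsBounded Ω) (hm : MeasurableSet Ω) (t : ℝ) :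
    LinearMap.BilinForm ℝ (EnergySpace Ω) :=
  LinearMap.mk₂ ℝ (fun u v => formL u v - t * inner ℝ u.toLp v.toLp)
    (fun u v w => by
      rw [formL_add_left hΩ hm, show (u + v).toLp = u.toLp + v.toLp from rfl, inner_add_left]
      ring)
    (fun c u v => by
      rw [formL_smul_left, show (c • u).toLp = c • u.toLp from rfl, real_inner_smul_left,
        smul_eq_mul]
      ring)
    (fun u v w => by
      rw [formL_comm, formL_add_left hΩ hm, formL_comm v, formL_comm w,
        show (v + w).toLp = v.toLp + w.toLp from rfl, inner_add_right]
      ring)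
    (fun c u v => by
      rw [formL_comm, formL_smul_left, formL_comm v, show (c • v).toLp = c • v.toLp from rfl,
        real_inner_smul_right, smul_eq_mul]
      ring)

/-- A bound for the lower order terms of `𝓔_L`. -/
def lowerOrderBound (Ω : Set (Space N)) : ℝ := cConst N * volume.real Ω + |rhoConst N|

lemma abs_formL_sub_le (hΩ : Bornology.IsBounded Ω) (hm : MeasurableSet Ω) (u v : EnergySpace Ω) :
    |formL u v - inner ℝ u v| ≤ lowerOrderBound Ω * (‖u.toLp‖ * ‖v.toLp‖) := by
  rw [show formL u v - inner ℝ u v = rhoConst N * inner ℝ u.toLp v.toLp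
    - cConst N * kerForm jKer u v by rw [formL_eq]; ring]
  refine (abs_sub _ _).trans ?_
  rw [abs_mul, abs_mul, abs_of_nonneg (cConst_nonneg N), lowerOrderBound, add_mul, add_comm,
    mul_assoc]
  have h1 := abs_kerForm_le_norm hΩ hm measurable_jKer abs_jKer_le_one u v
  rw [one_mul] at h1
  exact add_le_add (mul_le_mul_of_nonneg_left h1 (cConst_nonneg N))
    (mul_le_mul_of_nonneg_left (abs_real_inner_le_norm _ _) (abs_nonneg _))

section Kernel

open Filter Topology

lemma not_integrable_kKer (hN : 1 ≤ N) : ¬ Integrable (kKer : Space N → ℝ) := by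
  have : Nonempty (Fin N) := ⟨⟨0, hN⟩⟩
  have h1 : (kKer : Space N → ℝ) = fun z => (Iio (1 : ℝ)).indicator (fun y => 1 / y ^ N) ‖z‖ := by
    funext z
    simp [kKer, Set.indicator]
  intro h
  rw [h1, integrable_fun_norm_addHaar volume (f := (Iio (1 : ℝ)).indicator (fun y => 1 / y ^ N)),
    finrank_euclideanSpace_fin] at h
  have h2 : IntegrableOn (fun y : ℝ => y⁻¹) (Ioc 0 1) := by
    rw [integrableOn_Ioc_iff_integrableOn_Ioo]
    refine (h.mono_set Ioo_subset_Ioi_self).congr_fun (fun y hy => ?_) measurableSet_Ioo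
    have hy0 : y ≠ 0 := hy.1.ne'
    simp only [Set.indicator, mem_Iio, hy.2, if_true, smul_eq_mul]
    obtain ⟨n, rfl⟩ := Nat.exists_eq_add_of_le' hN
    rw [Nat.add_sub_cancel, pow_succ]
    field_simp
  have h3 := (intervalIntegrable_iff_integrableOn_Ioc_of_le zero_le_one).2 h2
  simp [intervalIntegrable_inv_iff] at h3

/-- The truncated kernel `min(k, m)`. -/
def truncKer (m : ℕ) (z : Space N) : ℝ := min (kKer z) m

lemma truncKer_nonneg (m : ℕ) (z : Space N) : 0 ≤ truncKer m z :=
  le_min (kKer_nonneg z) (Nat.cast_nonneg m)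

lemma truncKer_le_kKer (m : ℕ) (z : Space N) : truncKer m z ≤ kKer z := min_le_left _ _

lemma abs_truncKer_le (m : ℕ) (z : Space N) : |truncKer m z| ≤ m := by
  rw [abs_of_nonneg (truncKer_nonneg m z)]
  exact min_le_right _ _

lemma truncKer_neg (m : ℕ) (z : Space N) : truncKer m (-z) = truncKer m z := by
  rw [truncKer, kKer_neg, truncKer]

lemma measurable_truncKer (m : ℕ) : Measurable (truncKer m : Space N → ℝ) :=
  measurable_kKer.min measurable_const

lemma integrable_truncKer (m : ℕ) : Integrable (truncKer m : Space N → ℝ) := by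
  have h : Integrable ((Metric.ball (0 : Space N) 1).indicator fun _ => (m : ℝ)) :=
    (integrable_indicator_iff measurableSet_ball).2
      (integrableOn_const Metric.isBounded_ball.measure_lt_top.ne)
  refine h.mono' (measurable_truncKer m).aestronglyMeasurable
    (Eventually.of_forall fun z => ?_)
  by_cases hz : z ∈ Metric.ball (0 : Space N) 1
  · rw [indicator_of_mem hz]
    exact abs_truncKer_le m z
  · simp [truncKer, kKer, hz]

lemma tendsto_integral_truncKer (hN : 1 ≤ N) :
    Tendsto (fun m => ∫ z : Space N, truncKer m z) atTop atTop := by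
  have htop : ∫⁻ z : Space N, ENNReal.ofReal (kKer z) = ⊤ := by
    by_contra h
    exact not_integrable_kKer hN
      ⟨measurable_kKer.aestronglyMeasurable,
        (hasFiniteIntegral_iff_ofReal (Eventually.of_forall kKer_nonneg)).2 (lt_top_iff_ne_top.2 h)⟩
  have h1 : Tendsto (fun m => ∫⁻ z : Space N, ENNReal.ofReal (truncKer m z)) atTop
      (𝓝 (∫⁻ z : Space N, ENNReal.ofReal (kKer z))) := by
    refine lintegral_tendsto_of_tendsto_of_monotone
      (fun m => (measurable_truncKer m).ennreal_ofReal.aemeasurable)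
      (Eventually.of_forall fun z a b hab => ENNReal.ofReal_le_ofReal
        (min_le_min_left _ (Nat.cast_le.2 hab)))
      (Eventually.of_forall fun z => ?_)
    refine tendsto_const_nhds.congr' ?_
    filter_upwards [eventually_ge_atTop ⌈kKer z⌉₊] with m hm
    rw [truncKer, min_eq_left (Nat.ceil_le.1 hm)]
  rw [htop] at h1
  refine tendsto_atTop.2 fun b => ?_
  filter_upwards [h1.eventually (eventually_gt_nhds (ENNReal.ofReal_lt_top (r := b)))] with m hm
  rw [← ofReal_integral_eq_lintegral_ofReal (integrable_truncKer m)
    (Eventually.of_forall (truncKer_nonneg m))] at hm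
  exact (ENNReal.ofReal_lt_ofReal_iff'.1 hm).1.le

end Kernel

section Poincare

/-- The squared `L²` modulus of continuity of `u` in the direction `h`. -/
def shiftEnergy (u : Space N → ℝ) (h : Space N) : ENNReal := ∫⁻ x, ‖u (x + h) - u x‖ₑ ^ 2

lemma lintegral_formIntegrand_eq {u : Space N → ℝ} (hu : Measurable u) :
    ∫⁻ p, ENNReal.ofReal (formIntegrand u u p) ∂(volume.prod volume) =
      ∫⁻ h, ENNReal.ofReal (kKer h) * shiftEnergy u h := by
  have hm : Measurable fun p : Space N × Space N => ENNReal.ofReal (formIntegrand u u p) := by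
    unfold formIntegrand
    have := measurable_kKer (N := N)
    fun_prop
  rw [← (measurePreserving_prod_add (volume : Measure (Space N)) volume).lintegral_comp hm,
    lintegral_prod_symm' (fun p : Space N × Space N =>
      ENNReal.ofReal (formIntegrand u u (p.1, p.1 + p.2))) (hm.comp (by fun_prop))]
  refine lintegral_congr fun h => ?_
  rw [shiftEnergy, ← lintegral_const_mul _ (by fun_prop)]
  refine lintegral_congr fun x => ?_
  simp only [formIntegrand]
  rw [sub_add_cancel_left, kKer_neg, mul_comm, ENNReal.ofReal_mul (kKer_nonneg h), ← sq,
    ← enorm_pow, ← neg_sub (u (x + h)), neg_sq, Real.enorm_eq_ofReal (sq_nonneg _)]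

lemma eLpNorm_two_sq (f : Space N → ℝ) : eLpNorm f 2 volume ^ 2 = ∫⁻ x, ‖f x‖ₑ ^ 2 := by
  have := eLpNorm_nnreal_pow_eq_lintegral (f := f) (μ := volume) (p := 2) two_ne_zero
  simpa using this

lemma eLpNorm_shift_nsmul_le {u : Space N → ℝ} (hu : Measurable u) (h : Space N) (m : ℕ) :
    eLpNorm (fun x => u (x + m • h) - u x) 2 volume ≤
      m * eLpNorm (fun x => u (x + h) - u x) 2 volume := by
  induction m with
  | zero => simp
  | succ m ih =>
    have h1 : (fun x => u (x + (m + 1) • h) - u x) =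
        (fun x => u ((x + m • h) + h) - u (x + m • h)) + fun x => u (x + m • h) - u x := by
      funext x
      simp only [Pi.add_apply, succ_nsmul, add_assoc, sub_add_sub_cancel]
    have h2 : eLpNorm (fun x => u ((x + m • h) + h) - u (x + m • h)) 2 volume =
        eLpNorm (fun x => u (x + h) - u x) 2 volume :=
      eLpNorm_comp_measurePreserving (g := fun x => u (x + h) - u x)
        (Measurable.aestronglyMeasurable (by fun_prop))
        (measurePreserving_add_right volume (m • h))
    rw [h1]
    refine (eLpNorm_add_le (Measurable.aestronglyMeasurable (by fun_prop))
      (Measurable.aestronglyMeasurable (by fun_prop)) (by norm_num)).trans ?_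
    rw [h2, Nat.cast_succ, add_mul, one_mul, add_comm]
    gcongr

lemma eLpNorm_le_shift {u : Space N → ℝ} {R : ℝ}
    (hu0 : ∀ᵐ x, x ∉ Metric.ball (0 : Space N) R → u x = 0)
    {h : Space N} (hh : 2 * R ≤ ‖h‖) :
    eLpNorm u 2 volume ≤ eLpNorm (fun x => u (x + h) - u x) 2 volume := by
  refine eLpNorm_mono_ae ?_
  filter_upwards [hu0, (measurePreserving_add_right volume h).quasiMeasurePreserving.ae hu0]
    with x hx hxh
  by_cases hb : x ∈ Metric.ball (0 : Space N) R
  · have hb' : x + h ∉ Metric.ball (0 : Space N) R := by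
      rw [mem_ball_zero_iff] at hb ⊢
      have := norm_sub_le (x + h) x
      rw [add_sub_cancel_left] at this
      linarith
    rw [hxh hb', zero_sub, norm_neg]
  · rw [hx hb, norm_zero]
    exact norm_nonneg _

lemma one_le_kKer {h : Space N} (h0 : h ≠ 0) (h1 : ‖h‖ < 1) : 1 ≤ kKer h := by
  have hp : 0 < ‖h‖ := norm_pos_iff.2 h0
  rw [kKer, indicator_of_mem (by simpa using h1), one_le_div (by positivity)]
  exact pow_le_one₀ hp.le h1.le

lemma EnergySpace.lintegral_formIntegrand (u : EnergySpace Ω) :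
    ∫⁻ p, ENNReal.ofReal (formIntegrand u u p) ∂(volume.prod volume) =
      ENNReal.ofReal (∫ p, formIntegrand u u p ∂(volume.prod volume)) :=
  (ofReal_integral_eq_lintegral_ofReal (u.integrable u) (Filter.Eventually.of_forall fun _ =>
    mul_nonneg (mul_self_nonneg _) (kKer_nonneg _))).symm

lemma EnergySpace.lintegral_enorm_sq (u : EnergySpace Ω) :
    ∫⁻ x, ‖u x‖ₑ ^ 2 = ENNReal.ofReal (‖u.toLp‖ ^ 2) := by
  rw [norm_toLp_sq, ofReal_integral_eq_lintegral_ofReal u.integrable_sq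
    (Filter.Eventually.of_forall fun _ => sq_nonneg _)]
  refine lintegral_congr fun x => ?_
  rw [← enorm_pow, Real.enorm_eq_ofReal (sq_nonneg _)]

lemma cConst_pos (hN : 1 ≤ N) : 0 < cConst N :=
  mul_pos (Real.rpow_pos_of_pos Real.pi_pos _)
    (Real.Gamma_pos_of_pos (by have : (1 : ℝ) ≤ N := by exact_mod_cast hN
                               linarith))

/-- The Poincaré inequality on a bounded set. -/
lemma exists_poincare (hN : 1 ≤ N) (hΩ : Bornology.IsBounded Ω) :
    ∃ C : ℝ, 0 ≤ C ∧ ∀ u : EnergySpace Ω, ‖u.toLp‖ ^ 2 ≤ C * ‖u‖ ^ 2 := by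
  have : Nonempty (Fin N) := ⟨⟨0, hN⟩⟩
  obtain ⟨R, hR⟩ := hΩ.subset_ball (0 : Space N)
  obtain ⟨m, hm⟩ := exists_nat_ge (4 * R)
  set A : Set (Space N) := {h | 1 / 2 < ‖h‖ ∧ ‖h‖ < 1} with hA
  have hAo : IsOpen A := (isOpen_lt continuous_const continuous_norm).inter
    (isOpen_lt continuous_norm continuous_const)
  have hAne : A.Nonempty := by
    obtain ⟨h, hh⟩ := exists_norm_eq (Space N) (c := 3 / 4) (by norm_num)
    exact ⟨h, by rw [hh]; norm_num, by rw [hh]; norm_num⟩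
  have hApos : 0 < volume A := hAo.measure_pos volume hAne
  have hAfin : volume A ≠ ⊤ := ne_top_of_le_ne_top
    (Metric.isBounded_ball (x := (0 : Space N)) (r := 1)).measure_lt_top.ne
    (measure_mono fun h hh => by simpa using hh.2)
  have hAr : 0 < volume.real A := ENNReal.toReal_pos hApos.ne' hAfin
  have hc := cConst_pos hN
  refine ⟨m ^ 2 / volume.real A * (2 / cConst N), by positivity, fun u => ?_⟩
  have hu0 : ∀ᵐ x, x ∉ Metric.ball (0 : Space N) R → u x = 0 := by
    filter_upwards [u.ae_eq_zero_of_notMem] with x hx h using hx fun h' => h (hR h')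
  have key : ∀ h ∈ A, ENNReal.ofReal (‖u.toLp‖ ^ 2) ≤
      (m : ENNReal) ^ 2 * (ENNReal.ofReal (kKer h) * shiftEnergy u h) := by
    intro h hh
    have h1 : 2 * R ≤ ‖m • h‖ := by
      rw [← Nat.cast_smul_eq_nsmul ℝ, norm_smul, Real.norm_natCast]
      nlinarith [hh.1, hh.2, Nat.cast_nonneg (α := ℝ) m]
    have h2 := (eLpNorm_le_shift hu0 h1).trans (eLpNorm_shift_nsmul_le u.measurable h m)
    have h3 := pow_le_pow_left' h2 2
    rw [mul_pow, eLpNorm_two_sq, eLpNorm_two_sq, u.lintegral_enorm_sq] at h3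
    refine h3.trans ?_
    gcongr
    have h0 : h ≠ 0 := norm_pos_iff.1 (by linarith [hh.1])
    exact le_mul_of_one_le_left' (ENNReal.one_le_ofReal.2 (one_le_kKer h0 hh.2))
  have h4 : ENNReal.ofReal (‖u.toLp‖ ^ 2) * volume A ≤
      (m : ENNReal) ^ 2 *
        ENNReal.ofReal (∫ p, formIntegrand u u p ∂(volume.prod volume)) := by
    rw [← u.lintegral_formIntegrand, lintegral_formIntegrand_eq u.measurable,
      ← lintegral_const_mul' _ _ (by simp), ← setLIntegral_const]
    exact (setLIntegral_mono' hAo.measurableSet key).trans (setLIntegral_le_lintegral _ _)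
  have hI : 0 ≤ ∫ p, formIntegrand u u p ∂(volume.prod volume) :=
    integral_nonneg fun p => mul_nonneg (mul_self_nonneg _) (kKer_nonneg _)
  have h5 := ENNReal.toReal_mono (by finiteness) h4
  rw [ENNReal.toReal_mul, ENNReal.toReal_mul, ENNReal.toReal_pow, ENNReal.toReal_natCast,
    ENNReal.toReal_ofReal (sq_nonneg _), ENNReal.toReal_ofReal hI] at h5
  rw [← form_self_eq, form]
  calc ‖u.toLp‖ ^ 2 = ‖u.toLp‖ ^ 2 * volume.real A / volume.real A := by field_simp
    _ ≤ (m ^ 2 * ∫ p, formIntegrand u u p ∂(volume.prod volume)) / volume.real A := by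
      exact div_le_div_of_nonneg_right h5 hAr.le
    _ = _ := by field_simp

end Poincare

section Compactness

open Filter Topology

lemma integrable_mul_sub {f g : Space N → ℝ} (hf : Integrable f) (hg : Integrable g)
    (hgneg : ∀ z, g (-z) = g z) :
    Integrable (fun p : Space N × Space N => f p.1 * g (p.1 - p.2)) (volume.prod volume) := by
  refine ((measurePreserving_prod_sub (volume : Measure (Space N))
    volume).integrable_comp_of_integrable (hf.mul_prod hg)).congr (Eventually.of_forall fun p => ?_)
  simp only [Function.comp]
  rw [← hgneg, neg_sub]

lemma integral_mul_sub (f : Space N → ℝ) {g : Space N → ℝ} (hgneg : ∀ z, g (-z) = g z) :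
    ∫ p : Space N × Space N, f p.1 * g (p.1 - p.2) ∂(volume.prod volume) =
      (∫ x, f x) * ∫ z, g z := by
  have h := (measurePreserving_prod_sub (volume : Measure (Space N)) volume).integral_comp'
    (f := MeasurableEquiv.shearSubRight (Space N)) (fun p => f p.1 * g p.2)
  rw [integral_prod_mul] at h
  rw [← h]
  refine integral_congr_ae (Eventually.of_forall fun p => ?_)
  change f p.1 * g (p.1 - p.2) = f p.1 * g (p.2 - p.1)
  rw [← hgneg, neg_sub]

/-- The energy of `w` for the truncated kernel, expanded, is at most the full energy. -/
lemma mass_mul_norm_sq_le (hΩ : Bornology.IsBounded Ω) (hm : MeasurableSet Ω) (m : ℕ)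
    (w : EnergySpace Ω) :
    (∫ z : Space N, truncKer m z) * ‖w.toLp‖ ^ 2 ≤
      (∫ p, formIntegrand w w p ∂(volume.prod volume)) / 2 + kerForm (truncKer m) w w := by
  have hi1 := integrable_mul_sub w.integrable_sq (integrable_truncKer m) (truncKer_neg m)
  have hi2 : Integrable (fun p : Space N × Space N => w p.2 ^ 2 * truncKer m (p.1 - p.2))
      (volume.prod volume) := by
    refine hi1.swap.congr (Eventually.of_forall fun p => ?_)
    simp only [Function.comp, Prod.fst_swap, Prod.snd_swap]
    rw [← truncKer_neg, neg_sub]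
  have hi3 := integrable_kerForm (measurable_truncKer m) (abs_truncKer_le m)
    (w.integrable_coe hΩ hm) (w.integrable_coe hΩ hm)
  have he1 := integral_mul_sub (fun x => w x ^ 2) (truncKer_neg (N := N) m)
  have he2 : ∫ p : Space N × Space N, w p.2 ^ 2 * truncKer m (p.1 - p.2) ∂(volume.prod volume) =
      (∫ x, w x ^ 2) * ∫ z : Space N, truncKer m z := by
    rw [← he1, ← integral_prod_swap]
    refine integral_congr_ae (Eventually.of_forall fun p => ?_)
    simp only [Prod.fst_swap, Prod.snd_swap]
    rw [← truncKer_neg, neg_sub]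
  have hle : ∫ p : Space N × Space N, (w p.1 ^ 2 * truncKer m (p.1 - p.2)
      + w p.2 ^ 2 * truncKer m (p.1 - p.2) - 2 * (w p.1 * w p.2 * truncKer m (p.1 - p.2)))
        ∂(volume.prod volume) ≤ ∫ p, formIntegrand w w p ∂(volume.prod volume) := by
    refine integral_mono ((hi1.add hi2).sub (hi3.const_mul 2)) (w.integrable w) fun p => ?_
    have h1 := mul_le_mul_of_nonneg_left (truncKer_le_kKer m (p.1 - p.2))
      (mul_self_nonneg (w p.1 - w p.2))
    simp only [formIntegrand]
    linarith
  have hi12 : Integrable (fun p : Space N × Space N => w p.1 ^ 2 * truncKer m (p.1 - p.2)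
      + w p.2 ^ 2 * truncKer m (p.1 - p.2)) (volume.prod volume) := hi1.add hi2
  rw [integral_sub hi12 (hi3.const_mul 2), integral_add hi1 hi2, he1, he2,
    integral_const_mul, ← w.norm_toLp_sq] at hle
  unfold kerForm
  linarith

/-- The convolution of `w` with the truncated kernel. -/
def truncConv (m : ℕ) (w : Space N → ℝ) (x : Space N) : ℝ := ∫ y, w y * truncKer m (x - y)

lemma memLp_truncKer_sub (m : ℕ) (x : Space N) : MemLp (fun y => truncKer m (x - y)) 2 := by
  refine (memLp_two_iff_integrable_sq (Measurable.aestronglyMeasurable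
    ((measurable_truncKer m).comp (measurable_const.sub measurable_id)))).2 ?_
  have h : Integrable fun z : Space N => truncKer m z ^ 2 := by
    simp only [sq]
    exact (integrable_truncKer m).mul_bdd (c := m) (measurable_truncKer m).aestronglyMeasurable
      (Eventually.of_forall (abs_truncKer_le m))
  exact h.comp_sub_left x

lemma truncConv_eq_inner (m : ℕ) (w : EnergySpace Ω) (x : Space N) :
    truncConv m w x = inner ℝ w.toLp (memLp_truncKer_sub m x).toLp := by
  rw [L2.inner_def]
  refine integral_congr_ae ?_
  filter_upwards [(memLp_truncKer_sub m x).coeFn_toLp] with y hy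
  rw [hy]
  simp [mul_comm]

lemma abs_truncConv_le (hΩ : Bornology.IsBounded Ω) (hm : MeasurableSet Ω) (m : ℕ)
    (w : EnergySpace Ω) (x : Space N) :
    |truncConv m w x| ≤ m * (√(volume.real Ω) * ‖w.toLp‖) := by
  refine abs_integral_le_integral_abs.trans (le_trans ?_
    (mul_le_mul_of_nonneg_left (w.integral_abs_le hΩ hm) (Nat.cast_nonneg m)))
  rw [← integral_const_mul]
  refine integral_mono_of_nonneg (Eventually.of_forall fun _ => abs_nonneg _)
    ((w.integrable_coe hΩ hm).abs.const_mul _) (Eventually.of_forall fun y => ?_)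
  simp only [abs_mul]
  rw [mul_comm (m : ℝ)]
  exact mul_le_mul_of_nonneg_left (abs_truncKer_le m _) (abs_nonneg _)

lemma measurable_truncConv (m : ℕ) (w : EnergySpace Ω) : Measurable (truncConv m w) := by
  have h : Measurable fun p : Space N × Space N => w p.2 * truncKer m (p.1 - p.2) :=
    (w.measurable.comp measurable_snd).mul
      ((measurable_truncKer m).comp (measurable_fst.sub measurable_snd))
  exact (h.stronglyMeasurable.integral_prod_right (ν := volume)).measurable

lemma integrableOn_truncConv_sq (hΩ : Bornology.IsBounded Ω) (hm : MeasurableSet Ω) (m : ℕ)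
    (w : EnergySpace Ω) : IntegrableOn (fun x => truncConv m w x ^ 2) Ω := by
  have : IsFiniteMeasure (volume.restrict Ω) :=
    isFiniteMeasure_restrict.2 hΩ.measure_lt_top.ne
  refine Integrable.of_bound ((measurable_truncConv m w).pow_const 2).aestronglyMeasurable
    ((m * (√(volume.real Ω) * ‖w.toLp‖)) ^ 2) (Eventually.of_forall fun x => ?_)
  rw [norm_pow, Real.norm_eq_abs]
  exact pow_le_pow_left₀ (abs_nonneg _) (abs_truncConv_le hΩ hm m w x) 2

lemma norm_sq_le_of_truncKer (hΩ : Bornology.IsBounded Ω) (hm : MeasurableSet Ω) (m : ℕ)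
    (w : EnergySpace Ω) {M : ℝ} (hM : M = ∫ z : Space N, truncKer m z) (hMpos : 0 < M) :
    ‖w.toLp‖ ^ 2 ≤ (∫ p, formIntegrand w w p ∂(volume.prod volume)) / M
      + (∫ x in Ω, truncConv m w x ^ 2) / M ^ 2 := by
  have h1 := mass_mul_norm_sq_le hΩ hm m w
  have h2 : kerForm (truncKer m) w w = ∫ x in Ω, w x * truncConv m w x := by
    unfold kerForm
    rw [integral_prod _ (integrable_kerForm (measurable_truncKer m) (abs_truncKer_le m)
      (w.integrable_coe hΩ hm) (w.integrable_coe hΩ hm))]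
    have h3 := EnergySpace.setIntegral_mul_eq (truncConv m w) w
    simp only [mul_comm (truncConv m w _)] at h3
    rw [h3]
    refine integral_congr_ae (Eventually.of_forall fun x => ?_)
    simp only [truncConv, mul_assoc]
    rw [integral_const_mul]
  have h4 : ∫ x in Ω, w x * truncConv m w x ≤
      M / 2 * ‖w.toLp‖ ^ 2 + 1 / (2 * M) * ∫ x in Ω, truncConv m w x ^ 2 := by
    rw [← w.massI_eq, massI, ← integral_const_mul, ← integral_const_mul,
      ← integral_add (w.integrable_sq.integrableOn.const_mul _)
        ((integrableOn_truncConv_sq hΩ hm m w).const_mul _)]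
    refine integral_mono ?_ ((w.integrable_sq.integrableOn.const_mul _).add
      ((integrableOn_truncConv_sq hΩ hm m w).const_mul _)) fun x => ?_
    · exact (w.integrable_coe hΩ hm).integrableOn.mul_bdd
        (measurable_truncConv m w).aestronglyMeasurable
        (Eventually.of_forall (abs_truncConv_le hΩ hm m w))
    · have h6 := sq_nonneg (M * w x - truncConv m w x)
      rw [← sub_nonneg]
      calc (0 : ℝ) ≤ 1 / (2 * M) * (M * w x - truncConv m w x) ^ 2 := by positivity
        _ = _ := by field_simp; ring
  rw [h2, ← hM] at h1
  have h5 : M / 2 * ‖w.toLp‖ ^ 2 ≤ (∫ p, formIntegrand w w p ∂(volume.prod volume)) / 2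
      + 1 / (2 * M) * ∫ x in Ω, truncConv m w x ^ 2 := by linarith
  calc ‖w.toLp‖ ^ 2 = (M / 2 * ‖w.toLp‖ ^ 2) * (2 / M) := by field_simp
    _ ≤ _ := mul_le_mul_of_nonneg_right h5 (by positivity)
    _ = _ := by field_simp

lemma exists_weakly_convergent_subseq {H : Type*} [NormedAddCommGroup H] [InnerProductSpace ℝ H]
    [TopologicalSpace.SeparableSpace H] {u : ℕ → H} {A : ℝ} (hu : ∀ n, ‖u n‖ ≤ A) :
    ∃ σ : ℕ → ℕ, StrictMono σ ∧
      ∀ f : H, ∃ l : ℝ, Tendsto (fun n => inner ℝ (u (σ n)) f) atTop (𝓝 l) := by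
  obtain ⟨φ, -, σ, hσ, hlim⟩ := WeakDual.isSeqCompact_closedBall ℝ H 0 A
    (x := fun n => StrongDual.toWeakDual (innerSL ℝ (u n))) (fun n => by simpa using hu n)
  refine ⟨σ, hσ, fun f => ⟨φ f, ?_⟩⟩
  exact ((WeakDual.eval_continuous f).tendsto φ).comp hlim

/-- The embedding of `ℍ(Ω)` into `L²` is compact. -/
lemma exists_convergent_subseq (hN : 1 ≤ N) (hΩ : Bornology.IsBounded Ω) (hm : MeasurableSet Ω)
    {u : ℕ → EnergySpace Ω} {A : ℝ} (hu : ∀ n, ‖u n‖ ≤ A) :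
    ∃ σ : ℕ → ℕ, StrictMono σ ∧ ∃ U : Lp ℝ 2 (volume : Measure (Space N)),
      Tendsto (fun n => (u (σ n)).toLp) atTop (𝓝 U) := by
  obtain ⟨C, hC, hP⟩ := exists_poincare (Ω := Ω) hN hΩ
  have hc := cConst_pos hN
  have hL (n : ℕ) : ‖(u n).toLp‖ ≤ √(C * A ^ 2) := by
    refine Real.le_sqrt_of_sq_le ((hP _).trans ?_)
    have := pow_le_pow_left₀ (norm_nonneg _) (hu n) 2
    gcongr
  have : Fact ((2 : ENNReal) ≠ ⊤) := ⟨by norm_num⟩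
  obtain ⟨σ, hσ, hweak⟩ := exists_weakly_convergent_subseq hL
  refine ⟨σ, hσ, cauchySeq_tendsto_of_complete (cauchySeq_iff_tendsto_dist_atTop_0.2 ?_)⟩
  set w : ℕ × ℕ → EnergySpace Ω := fun p => u (σ p.1) - u (σ p.2) with hw
  have hwL (p : ℕ × ℕ) : ‖(w p).toLp‖ ≤ 2 * √(C * A ^ 2) :=
    (norm_sub_le (u (σ p.1)).toLp (u (σ p.2)).toLp).trans (by linarith [hL (σ p.1), hL (σ p.2)])
  have hwF (p : ℕ × ℕ) : ∫ q, formIntegrand (w p) (w p) q ∂(volume.prod volume) ≤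
      2 / cConst N * (2 * A) ^ 2 := by
    have h1 : ‖w p‖ ≤ 2 * A := (norm_sub_le _ _).trans (by linarith [hu (σ p.1), hu (σ p.2)])
    have h2 := pow_le_pow_left₀ (norm_nonneg _) h1 2
    rw [← form_self_eq, form] at h2
    calc _ = 2 / cConst N * (cConst N / 2 *
          ∫ q, formIntegrand (w p) (w p) q ∂(volume.prod volume)) := by field_simp
      _ ≤ _ := mul_le_mul_of_nonneg_left h2 (by positivity)
  have hconv (m : ℕ) : Tendsto (fun p => ∫ x in Ω, truncConv m (w p) x ^ 2) atTop (𝓝 0) := by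
    have : IsFiniteMeasure (volume.restrict Ω) :=
      isFiniteMeasure_restrict.2 hΩ.measure_lt_top.ne
    have h := tendsto_integral_filter_of_dominated_convergence (μ := volume.restrict Ω)
      (l := (atTop : Filter (ℕ × ℕ))) (F := fun p x => truncConv m (w p) x ^ 2) (f := fun _ => 0)
      (fun _ => (m * (√(volume.real Ω) * (2 * √(C * A ^ 2)))) ^ 2)
      (Eventually.of_forall fun p =>
        ((measurable_truncConv m (w p)).pow_const 2).aestronglyMeasurable)
      (Eventually.of_forall fun p => Eventually.of_forall fun x => ?_)
      (integrable_const _) (Eventually.of_forall fun x => ?_)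
    · simpa using h
    · rw [norm_pow, Real.norm_eq_abs]
      refine pow_le_pow_left₀ (abs_nonneg _) ((abs_truncConv_le hΩ hm m (w p) x).trans ?_) 2
      have := hwL p
      gcongr
    · obtain ⟨l, hl⟩ := hweak (memLp_truncKer_sub m x).toLp
      have h1 : Tendsto (fun p : ℕ × ℕ => truncConv m (w p) x) atTop (𝓝 (l - l)) := by
        rw [← prod_atTop_atTop_eq]
        refine ((hl.comp tendsto_fst).sub (hl.comp tendsto_snd)).congr fun p => ?_
        rw [truncConv_eq_inner]
        exact (inner_sub_left _ _ _).symm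
      simpa using h1.pow 2
  have hsq : Tendsto (fun p => ‖(w p).toLp‖ ^ 2) atTop (𝓝 0) := by
    refine tendsto_order.2 ⟨fun a ha => Eventually.of_forall fun p => ha.trans_le (sq_nonneg _),
      fun ε hε => ?_⟩
    obtain ⟨m, hm1, hm2⟩ := ((tendsto_integral_truncKer hN).eventually_gt_atTop
      (2 * (2 / cConst N * (2 * A) ^ 2) / ε) |>.and
      ((tendsto_integral_truncKer hN).eventually_gt_atTop 0)).exists
    set M := ∫ z : Space N, truncKer m z with hM
    have h3 := ((hconv m).div_const (M ^ 2)).eventually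
      (gt_mem_nhds (by simpa using half_pos hε : 0 / M ^ 2 < ε / 2))
    filter_upwards [h3] with p hp
    have h4 := norm_sq_le_of_truncKer hΩ hm m (w p) hM hm2
    have h5 : (∫ q, formIntegrand (w p) (w p) q ∂(volume.prod volume)) / M ≤ ε / 2 := by
      rw [div_le_iff₀ hm2]
      rw [div_lt_iff₀ hε] at hm1
      linarith [hwF p]
    linarith
  have h6 := hsq.sqrt
  simp only [Real.sqrt_sq (norm_nonneg _), Real.sqrt_zero] at h6
  exact h6.congr fun p => (dist_eq_norm _ _).symm

end Compactness

section TestFunction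

open Filter Topology

lemma integrable_norm_sq_mul_kKer (hN : 1 ≤ N) :
    Integrable fun z : Space N => ‖z‖ ^ 2 * kKer z := by
  have : Nonempty (Fin N) := ⟨⟨0, hN⟩⟩
  have h1 : (fun z : Space N => ‖z‖ ^ 2 * kKer z) =
      fun z => (Iio (1 : ℝ)).indicator (fun y => y ^ 2 / y ^ N) ‖z‖ := by
    funext z
    by_cases hz : ‖z‖ < 1 <;> simp [kKer, Set.indicator, hz, div_eq_mul_inv]
  rw [h1, integrable_fun_norm_addHaar volume
    (f := (Iio (1 : ℝ)).indicator (fun y => y ^ 2 / y ^ N)), finrank_euclideanSpace_fin]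
  have h2 : IntegrableOn ((Iio (1 : ℝ)).indicator fun y => y) (Ioi 0) := by
    rw [IntegrableOn, integrable_indicator_iff measurableSet_Iio, IntegrableOn,
      Measure.restrict_restrict measurableSet_Iio, inter_comm, Ioi_inter_Iio]
    exact (continuous_id.integrableOn_Icc (a := (0 : ℝ)) (b := 1)).mono_set Ioo_subset_Icc_self
  refine h2.congr_fun (fun y hy => ?_) measurableSet_Ioi
  have hy0 : y ≠ 0 := (mem_Ioi.1 hy).ne'
  by_cases hy1 : y < 1
  · simp only [Set.indicator, mem_Iio, hy1, if_true, smul_eq_mul]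
    obtain ⟨n, rfl⟩ := Nat.exists_eq_add_of_le' hN
    rw [Nat.add_sub_cancel]
    field_simp
    ring
  · simp [Set.indicator, hy1]

/-- The tent function of radius `r` centred at `x₀`. -/
def tent (x₀ : Space N) (r : ℝ) (x : Space N) : ℝ := max 0 (r - ‖x - x₀‖)

lemma continuous_tent (x₀ : Space N) (r : ℝ) : Continuous (tent x₀ r) := by
  unfold tent
  fun_prop

lemma tent_eq_zero {x₀ x : Space N} {r : ℝ} (hx : x ∉ Metric.ball x₀ r) : tent x₀ r x = 0 := by
  rw [mem_ball_iff_norm, not_lt] at hx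
  exact max_eq_left (by linarith)

lemma hasCompactSupport_tent (x₀ : Space N) (r : ℝ) : HasCompactSupport (tent x₀ r) :=
  HasCompactSupport.intro (isCompact_closedBall x₀ r) fun _ hx =>
    tent_eq_zero fun h => hx (Metric.ball_subset_closedBall h)

lemma sq_tent_sub_le (x₀ : Space N) (r : ℝ) (x y : Space N) :
    (tent x₀ r x - tent x₀ r y) * (tent x₀ r x - tent x₀ r y) ≤ ‖x - y‖ ^ 2 := by
  rw [← sq, sq_le_sq, abs_norm]
  unfold tent
  rw [max_comm, max_comm 0]
  refine (abs_max_sub_max_le_abs _ _ _).trans ?_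
  rw [sub_sub_sub_cancel_left]
  refine (abs_norm_sub_norm_le _ _).trans (le_of_eq ?_)
  rw [sub_sub_sub_cancel_right, norm_sub_rev]

lemma integrable_formIntegrand_tent (hN : 1 ≤ N) (x₀ : Space N) (r : ℝ) :
    Integrable (formIntegrand (tent x₀ r) (tent x₀ r)) (volume.prod volume) := by
  have hb : Integrable ((Metric.ball x₀ r).indicator fun _ => (1 : ℝ)) :=
    (integrable_indicator_iff measurableSet_ball).2
      (integrableOn_const Metric.isBounded_ball.measure_lt_top.ne)
  have hneg (z : Space N) : ‖-z‖ ^ 2 * kKer (-z) = ‖z‖ ^ 2 * kKer z := by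
    rw [norm_neg, kKer_neg]
  have h1 := integrable_mul_sub hb (integrable_norm_sq_mul_kKer hN) hneg
  have hm : AEStronglyMeasurable (tent x₀ r) volume := (continuous_tent x₀ r).aestronglyMeasurable
  refine (h1.add h1.swap).mono' (aestronglyMeasurable_formIntegrand hm hm)
    (Eventually.of_forall fun p => ?_)
  simp only [Pi.add_apply, Function.comp, Prod.fst_swap, Prod.snd_swap]
  rw [← neg_sub p.1 p.2, hneg, ← add_mul, formIntegrand,
    Real.norm_of_nonneg (mul_nonneg (mul_self_nonneg _) (kKer_nonneg _))]
  have hk : 0 ≤ ‖p.1 - p.2‖ ^ 2 * kKer (p.1 - p.2) :=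
    mul_nonneg (sq_nonneg _) (kKer_nonneg _)
  have hle := mul_le_mul_of_nonneg_right (sq_tent_sub_le x₀ r p.1 p.2) (kKer_nonneg (p.1 - p.2))
  have h01 (x : Space N) : 0 ≤ (Metric.ball x₀ r).indicator (fun _ => (1 : ℝ)) x :=
    indicator_nonneg (fun _ _ => zero_le_one) x
  by_cases h1 : p.1 ∈ Metric.ball x₀ r
  · refine hle.trans (le_mul_of_one_le_left hk ?_)
    rw [indicator_of_mem h1]
    linarith [h01 p.2]
  by_cases h2 : p.2 ∈ Metric.ball x₀ r
  · refine hle.trans (le_mul_of_one_le_left hk ?_)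
    rw [indicator_of_mem h2]
    linarith [h01 p.1]
  · rw [tent_eq_zero h1, tent_eq_zero h2, indicator_of_notMem h1, indicator_of_notMem h2]
    simp

lemma unitSphere_nonempty (hN : 1 ≤ N) (hΩ : IsOpen Ω) (hne : Ω.Nonempty) :
    (unitSphere Ω).Nonempty := by
  obtain ⟨x₀, hx₀⟩ := hne
  obtain ⟨r, hr, hball⟩ := Metric.isOpen_iff.1 hΩ x₀ hx₀
  have hmem : MemLp (tent x₀ r) 2 volume :=
    (continuous_tent x₀ r).memLp_of_hasCompactSupport (hasCompactSupport_tent x₀ r)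
  have hae := hmem.coeFn_toLp
  let u : EnergySpace Ω := ⟨hmem.toLp, by
    filter_upwards [hae] with x hx hxΩ
    rw [hx, tent_eq_zero fun h => hxΩ (hball h)], by
    rw [integrable_congr (formIntegrand_congr hae hae)]
    exact integrable_formIntegrand_tent hN x₀ r⟩
  have hu : u.toLp ≠ 0 := by
    intro h0
    have h1 : tent x₀ r =ᵐ[volume] 0 := by
      refine hae.symm.trans ?_
      change u.toLp =ᵐ[volume] 0
      rw [h0]
      exact Lp.coeFn_zero _ _ _
    have h2 := ((continuous_tent x₀ r).ae_eq_iff_eq volume continuous_zero).1 h1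
    have h3 := congrFun h2 x₀
    simp only [tent, sub_self, norm_zero, sub_zero, Pi.zero_apply, max_eq_left_iff] at h3
    linarith
  refine ⟨‖u.toLp‖⁻¹ • u, ?_⟩
  have : (‖u.toLp‖⁻¹ • u).toLp = ‖u.toLp‖⁻¹ • u.toLp := rfl
  rw [unitSphere, mem_ofPred_eq, EnergySpace.massI_eq, this, norm_smul, norm_inv, norm_norm,
    inv_mul_cancel₀ (norm_ne_zero_iff.2 hu), one_pow]

end TestFunction

section Minimizer

open Filter Topology

lemma mem_unitSphere_iff (u : EnergySpace Ω) : u ∈ unitSphere Ω ↔ ‖u.toLp‖ ^ 2 = 1 := by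
  rw [unitSphere, mem_ofPred_eq, EnergySpace.massI_eq]

lemma norm_sq_sub_le_formL (hΩ : Bornology.IsBounded Ω) (hm : MeasurableSet Ω)
    (u : EnergySpace Ω) : ‖u‖ ^ 2 - lowerOrderBound Ω * ‖u.toLp‖ ^ 2 ≤ formL u u := by
  have h := (abs_le.1 (abs_formL_sub_le hΩ hm u u)).1
  rw [real_inner_self_eq_norm_sq, ← sq] at h
  linarith

lemma bddBelow_formL (hΩ : Bornology.IsBounded Ω) (hm : MeasurableSet Ω) :
    BddBelow ((fun u : EnergySpace Ω => formL u u) '' unitSphere Ω) := by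
  refine ⟨-lowerOrderBound Ω, ?_⟩
  rintro _ ⟨u, hu, rfl⟩
  have h := norm_sq_sub_le_formL hΩ hm u
  rw [(mem_unitSphere_iff u).1 hu] at h
  simp only
  linarith [sq_nonneg ‖u‖]

lemma firstEigenvalue_le (hΩ : Bornology.IsBounded Ω) (hm : MeasurableSet Ω) {u : EnergySpace Ω}
    (hu : u ∈ unitSphere Ω) : firstEigenvalue Ω ≤ formL u u :=
  csInf_le (bddBelow_formL hΩ hm) ⟨u, hu, rfl⟩

/-- The variational characterization of `λ₁^L`, in homogeneous form. -/
lemma firstEigenvalue_mul_le (hΩ : Bornology.IsBounded Ω) (hm : MeasurableSet Ω)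
    (u : EnergySpace Ω) : firstEigenvalue Ω * ‖u.toLp‖ ^ 2 ≤ formL u u := by
  by_cases h0 : u.toLp = 0
  · have hu : u = (0 : ℝ) • u := by
      rw [zero_smul]
      exact Subtype.ext h0
    rw [h0, hu, formL_smul_left]
    simp
  · have hn : ‖u.toLp‖ ≠ 0 := norm_ne_zero_iff.2 h0
    have h1 : ‖u.toLp‖⁻¹ • u ∈ unitSphere Ω := by
      have : (‖u.toLp‖⁻¹ • u).toLp = ‖u.toLp‖⁻¹ • u.toLp := rfl
      rw [mem_unitSphere_iff, this, norm_smul, norm_inv, norm_norm, inv_mul_cancel₀ hn, one_pow]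
    have h2 := firstEigenvalue_le hΩ hm h1
    rw [formL_smul_left, formL_comm, formL_smul_left] at h2
    calc _ ≤ (‖u.toLp‖⁻¹ * (‖u.toLp‖⁻¹ * formL u u)) * ‖u.toLp‖ ^ 2 :=
          mul_le_mul_of_nonneg_right h2 (sq_nonneg _)
      _ = _ := by field_simp

/-- The lower order part of `𝓔_L` is continuous for the `L²` norm. -/
lemma tendsto_formL_sub_norm_sq (hΩ : Bornology.IsBounded Ω) (hm : MeasurableSet Ω)
    {u : ℕ → EnergySpace Ω} {v : EnergySpace Ω}
    (h : Tendsto (fun n => (u n).toLp) atTop (𝓝 v.toLp)) :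
    Tendsto (fun n => formL (u n) (u n) - ‖u n‖ ^ 2) atTop (𝓝 (formL v v - ‖v‖ ^ 2)) := by
  have h1 (n : ℕ) : (formL (u n) (u n) - ‖u n‖ ^ 2) - (formL v v - ‖v‖ ^ 2) =
      (formL (u n - v) (u n) - inner ℝ (u n - v) (u n))
        + (formL (u n - v) v - inner ℝ (u n - v) v) := by
    have h2 := formL_add_left hΩ hm (u n - v) v (u n)
    have h3 := formL_add_left hΩ hm (u n - v) v v
    rw [sub_add_cancel] at h2 h3
    rw [inner_sub_left, inner_sub_left, real_inner_comm v (u n), real_inner_self_eq_norm_sq,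
      real_inner_self_eq_norm_sq]
    linarith [formL_comm v (u n)]
  have h4 : Tendsto (fun n => lowerOrderBound Ω * (‖(u n).toLp - v.toLp‖ * ‖(u n).toLp‖)
      + lowerOrderBound Ω * (‖(u n).toLp - v.toLp‖ * ‖v.toLp‖)) atTop (𝓝 0) := by
    have h5 := tendsto_iff_norm_sub_tendsto_zero.1 h
    simpa using ((h5.mul h.norm).const_mul (lowerOrderBound Ω)).add
      ((h5.mul_const ‖v.toLp‖).const_mul (lowerOrderBound Ω))
  rw [tendsto_iff_norm_sub_tendsto_zero]
  refine squeeze_zero (fun _ => norm_nonneg _) (fun n => ?_) h4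
  rw [h1 n]
  exact (norm_add_le _ _).trans (add_le_add (abs_formL_sub_le hΩ hm (u n - v) (u n))
    (abs_formL_sub_le hΩ hm (u n - v) v))

lemma integral_formIntegrand_eq (hN : 1 ≤ N) (u : EnergySpace Ω) :
    ∫ p, formIntegrand u u p ∂(volume.prod volume) = 2 / cConst N * ‖u‖ ^ 2 := by
  have := cConst_pos hN
  rw [← form_self_eq, form]
  field_simp

/-- Lower semicontinuity of the energy under a.e. convergence. -/
lemma lintegral_formIntegrand_le_liminf {u : ℕ → EnergySpace Ω} {U : Space N → ℝ}
    (hae : ∀ᵐ x, Tendsto (fun n => u n x) atTop (𝓝 (U x))) :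
    ∫⁻ p, ENNReal.ofReal (formIntegrand U U p) ∂(volume.prod volume) ≤
      liminf (fun n => ENNReal.ofReal (∫ p, formIntegrand (u n) (u n) p ∂(volume.prod volume)))
        atTop := by
  have h1 := Measure.quasiMeasurePreserving_fst (μ := (volume : Measure (Space N)))
    (ν := (volume : Measure (Space N)))
  have h2 := Measure.quasiMeasurePreserving_snd (μ := (volume : Measure (Space N)))
    (ν := (volume : Measure (Space N)))
  have h3 : ∀ᵐ p : Space N × Space N ∂(volume.prod volume),
      ENNReal.ofReal (formIntegrand U U p) =
        liminf (fun n => ENNReal.ofReal (formIntegrand (u n) (u n) p)) atTop := by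
    filter_upwards [h1.ae hae, h2.ae hae] with p hp1 hp2
    refine (Tendsto.liminf_eq (ENNReal.tendsto_ofReal ?_)).symm
    exact ((hp1.sub hp2).mul (hp1.sub hp2)).mul_const _
  rw [lintegral_congr_ae h3]
  simp only [← EnergySpace.lintegral_formIntegrand]
  exact lintegral_liminf_le' fun n =>
    (aestronglyMeasurable_formIntegrand (Lp.aestronglyMeasurable _)
      (Lp.aestronglyMeasurable _)).aemeasurable.ennreal_ofReal

lemma exists_minimizer (hN : 1 ≤ N) (hΩo : IsOpen Ω) (hΩ : Bornology.IsBounded Ω)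
    (hne : Ω.Nonempty) : ∃ u ∈ unitSphere Ω, formL u u ≤ firstEigenvalue Ω := by
  have hm := hΩo.measurableSet
  have hc := cConst_pos hN
  obtain ⟨s, -, hs, hsmem⟩ := exists_seq_tendsto_sInf
    ((unitSphere_nonempty hN hΩo hne).image fun u => formL u u) (bddBelow_formL hΩ hm)
  choose u huP hus using hsmem
  simp only at hus
  obtain ⟨B, hB⟩ := hs.bddAbove_range
  have hbound (n : ℕ) : ‖u n‖ ≤ √(B + lowerOrderBound Ω) := by
    refine Real.le_sqrt_of_sq_le ?_
    have h1 := norm_sq_sub_le_formL hΩ hm (u n)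
    rw [(mem_unitSphere_iff _).1 (huP n), hus] at h1
    linarith [hB ⟨n, rfl⟩]
  obtain ⟨σ, hσ, U, hU⟩ := exists_convergent_subseq hN hΩ hm hbound
  obtain ⟨τ, hτ, hae⟩ := (tendstoInMeasure_of_tendsto_Lp hU).exists_seq_tendsto_ae
  set v : ℕ → EnergySpace Ω := fun n => u (σ (τ n)) with hv
  have hστ : Tendsto (fun n => σ (τ n)) atTop atTop := hσ.tendsto_atTop.comp hτ.tendsto_atTop
  have hfatou := lintegral_formIntegrand_le_liminf (u := v) hae
  simp only [integral_formIntegrand_eq hN] at hfatou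
  have hU0 : ∀ᵐ x, x ∉ Ω → U x = 0 := by
    filter_upwards [hae, ae_all_iff.2 fun n => (v n).ae_eq_zero_of_notMem] with x hx h0 hxΩ
    refine tendsto_nhds_unique hx (tendsto_const_nhds.congr fun n => (h0 n hxΩ).symm)
  have hUint : Integrable (formIntegrand U U) (volume.prod volume) := by
    refine ⟨aestronglyMeasurable_formIntegrand (Lp.aestronglyMeasurable _)
      (Lp.aestronglyMeasurable _), (hasFiniteIntegral_iff_ofReal (Eventually.of_forall fun _ =>
        mul_nonneg (mul_self_nonneg _) (kKer_nonneg _))).2 (hfatou.trans_lt ?_)⟩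
    refine (liminf_le_of_le (by isBoundedDefault)
      (a := ENNReal.ofReal (2 / cConst N * √(B + lowerOrderBound Ω) ^ 2)) fun b hb => ?_).trans_lt
      ENNReal.ofReal_lt_top
    obtain ⟨n, hn⟩ := hb.exists
    refine hn.trans (ENNReal.ofReal_le_ofReal ?_)
    have := pow_le_pow_left₀ (norm_nonneg _) (hbound (σ (τ n))) 2
    gcongr
  let w : EnergySpace Ω := ⟨U, hU0, hUint⟩
  have hvw : Tendsto (fun n => (v n).toLp) atTop (𝓝 w.toLp) := hU.comp hτ.tendsto_atTop
  have hlow := tendsto_formL_sub_norm_sq hΩ hm hvw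
  have hform : Tendsto (fun n => formL (v n) (v n)) atTop (𝓝 (firstEigenvalue Ω)) :=
    (hs.comp hστ).congr fun n => (hus _).symm
  have hnorm : Tendsto (fun n => ‖v n‖ ^ 2) atTop
      (𝓝 (firstEigenvalue Ω - (formL w w - ‖w‖ ^ 2))) :=
    (hform.sub hlow).congr fun n => by ring
  refine ⟨w, ?_, ?_⟩
  · rw [mem_unitSphere_iff]
    refine tendsto_nhds_unique (hvw.norm.pow 2) (tendsto_const_nhds.congr fun n => ?_)
    exact ((mem_unitSphere_iff _).1 (huP (σ (τ n)))).symm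
  · rw [(ENNReal.tendsto_ofReal (hnorm.const_mul (2 / cConst N))).liminf_eq,
      show (U : Space N → ℝ) = w from rfl, w.lintegral_formIntegrand,
      integral_formIntegrand_eq hN, ENNReal.ofReal_le_ofReal_iff] at hfatou
    · have := le_of_mul_le_mul_left hfatou (by positivity)
      linarith
    · exact mul_nonneg (by positivity) (ge_of_tendsto' hnorm fun n => sq_nonneg _)

/-- The absolute value of an element of `ℍ(Ω)`. -/
def EnergySpace.absValue (u : EnergySpace Ω) : EnergySpace Ω :=
  ⟨|u.toLp|, by
    filter_upwards [u.ae_eq_zero_of_notMem, Lp.coeFn_abs u.toLp] with x hx h hxΩ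
    rw [h, hx hxΩ, abs_zero], by
    have h := Lp.coeFn_abs u.toLp
    rw [integrable_congr (formIntegrand_congr h h)]
    refine (u.integrable u).mono' (aestronglyMeasurable_formIntegrand
      u.measurable.abs.aestronglyMeasurable u.measurable.abs.aestronglyMeasurable)
      (Eventually.of_forall fun p => ?_)
    simp only [formIntegrand]
    rw [Real.norm_of_nonneg (mul_nonneg (mul_self_nonneg _) (kKer_nonneg _))]
    exact mul_le_mul_of_nonneg_right (abs_le_iff_mul_self_le.1 (abs_abs_sub_abs_le _ _))
      (kKer_nonneg _)⟩

lemma EnergySpace.coe_absValue (u : EnergySpace Ω) : u.absValue =ᵐ[volume] fun x => |u x| :=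
  Lp.coeFn_abs u.toLp

lemma formL_absValue_le (hΩ : Bornology.IsBounded Ω) (hm : MeasurableSet Ω) (u : EnergySpace Ω) :
    formL u.absValue u.absValue ≤ formL u u := by
  have h1 : form u.absValue u.absValue ≤ form u u := by
    unfold form
    refine mul_le_mul_of_nonneg_left ?_ (div_nonneg (cConst_nonneg N) two_pos.le)
    refine integral_mono_ae (u.absValue.integrable _) (u.integrable u) ?_
    filter_upwards [formIntegrand_congr u.coe_absValue u.coe_absValue] with p hp
    rw [hp]
    exact mul_le_mul_of_nonneg_right (abs_le_iff_mul_self_le.1 (abs_abs_sub_abs_le _ _))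
      (kKer_nonneg _)
  have h2 : kerForm jKer u u ≤ kerForm jKer u.absValue u.absValue := by
    unfold kerForm
    refine integral_mono_ae
      (integrable_kerForm measurable_jKer abs_jKer_le_one (u.integrable_coe hΩ hm)
        (u.integrable_coe hΩ hm))
      (integrable_kerForm measurable_jKer abs_jKer_le_one (u.absValue.integrable_coe hΩ hm)
        (u.absValue.integrable_coe hΩ hm)) ?_
    filter_upwards [ae_prod_of_ae u.coe_absValue u.coe_absValue] with p hp
    simp only [hp.1, hp.2, ← abs_mul]
    exact mul_le_mul_of_nonneg_right (le_abs_self _) (jKer_nonneg _)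
  have h3 : ‖u.absValue.toLp‖ = ‖u.toLp‖ := norm_abs_eq_norm u.toLp
  simp only [formL_eq, ← form_eq_inner, real_inner_self_eq_norm_sq u.toLp,
    real_inner_self_eq_norm_sq u.absValue.toLp, h3]
  have := mul_le_mul_of_nonneg_left h2 (cConst_nonneg N)
  linarith

/-- The Euler-Lagrange equation of a minimizer. -/
lemma formL_eq_of_minimizer (hΩ : Bornology.IsBounded Ω) (hm : MeasurableSet Ω)
    {u : EnergySpace Ω} (hu : u ∈ unitSphere Ω) (hle : formL u u ≤ firstEigenvalue Ω)
    (v : EnergySpace Ω) : formL u v = firstEigenvalue Ω * inner ℝ u.toLp v.toLp := by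
  have hnn (w : EnergySpace Ω) : 0 ≤ shiftedForm hΩ hm (firstEigenvalue Ω) w w := by
    have := firstEigenvalue_mul_le hΩ hm w
    simp only [shiftedForm, LinearMap.mk₂_apply, real_inner_self_eq_norm_sq]
    linarith
  have hsymm : LinearMap.IsSymm (shiftedForm hΩ hm (firstEigenvalue Ω)) := ⟨fun a b => by
    simp only [shiftedForm, LinearMap.mk₂_apply, RingHom.id_apply]
    rw [formL_comm, real_inner_comm]⟩
  have hcs := LinearMap.BilinForm.apply_sq_le_of_symm _ hnn hsymm u v
  have h0 : shiftedForm hΩ hm (firstEigenvalue Ω) u u = 0 := by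
    refine le_antisymm ?_ (hnn u)
    simp only [shiftedForm, LinearMap.mk₂_apply, real_inner_self_eq_norm_sq,
      (mem_unitSphere_iff u).1 hu]
    linarith
  rw [h0, zero_mul] at hcs
  have h1 := pow_eq_zero_iff two_ne_zero |>.1 (le_antisymm hcs (sq_nonneg _))
  simp only [shiftedForm, LinearMap.mk₂_apply] at h1
  linarith

lemma exists_isFirstEigenfunction (hN : 1 ≤ N) (hΩo : IsOpen Ω) (hΩ : Bornology.IsBounded Ω)
    (hne : Ω.Nonempty) : ∃ φ : EnergySpace Ω, IsFirstEigenfunction φ := by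
  have hm := hΩo.measurableSet
  obtain ⟨u, hu, hle⟩ := exists_minimizer hN hΩo hΩ hne
  have habs : u.absValue ∈ unitSphere Ω := by
    rw [mem_unitSphere_iff] at hu ⊢
    rwa [show ‖u.absValue.toLp‖ = ‖u.toLp‖ from norm_abs_eq_norm u.toLp]
  refine ⟨u.absValue, ?_, habs, fun v => ?_⟩
  · filter_upwards [u.coe_absValue] with x hx
    rw [hx]
    exact abs_nonneg _
  · rw [formL_eq_of_minimizer hΩ hm habs ((formL_absValue_le hΩ hm u).trans hle) v,
      EnergySpace.inner_toLp, EnergySpace.setIntegral_mul_eq]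

end Minimizer

section CriticalPoint

lemma hasFDerivAt_of_quadratic_remainder {E : Type*} [SeminormedAddCommGroup E] [NormedSpace ℝ E]
    {F : E → ℝ} {F' : E →L[ℝ] ℝ} {x : E} {C : ℝ}
    (h : ∀ y, |F y - F x - F' (y - x)| ≤ C * ‖y - x‖ ^ 2) : HasFDerivAt F F' x := by
  refine HasFDerivAt.of_isLittleO ?_
  refine (Asymptotics.IsBigO.of_bound C (g := fun y => ‖y - x‖ ^ 2)
    (Filter.Eventually.of_forall fun y => ?_)).trans_isLittleO ?_
  · rw [Real.norm_eq_abs, Real.norm_of_nonneg (sq_nonneg _)]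
    exact h y
  · have h1 : (fun y : E => y - x) =o[nhds x] fun _ => (1 : ℝ) := by
      rw [Asymptotics.isLittleO_one_iff]
      exact (continuous_id.sub continuous_const).tendsto' x 0 (sub_self x)
    have h2 := h1.norm_left.mul_isBigO (Asymptotics.isBigO_refl (fun y : E => ‖y - x‖) _)
    simp only [one_mul, ← sq] at h2
    exact h2.of_norm_right

/-- The embedding `ℍ(Ω) → L²` as a continuous linear map. -/
def toLpCLM {C : ℝ} (h : ∀ u : EnergySpace Ω, ‖u.toLp‖ ^ 2 ≤ C * ‖u‖ ^ 2) :
    EnergySpace Ω →L[ℝ] Lp ℝ 2 (volume : Measure (Space N)) :=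
  LinearMap.mkContinuous
    { toFun := fun u => u.toLp
      map_add' := fun _ _ => rfl
      map_smul' := fun _ _ => rfl } (√C) fun u => by
    have h1 := Real.le_sqrt_of_sq_le (h u)
    rwa [Real.sqrt_mul' _ (sq_nonneg _), Real.sqrt_sq (norm_nonneg _)] at h1

/-- The Fréchet derivative of `I` at `u`. -/
def massDeriv {C : ℝ} (h : ∀ u : EnergySpace Ω, ‖u.toLp‖ ^ 2 ≤ C * ‖u‖ ^ 2) (u : EnergySpace Ω) :
    EnergySpace Ω →L[ℝ] ℝ :=
  (2 : ℝ) • (innerSL ℝ u.toLp).comp (toLpCLM h)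

lemma massDeriv_apply {C : ℝ} (h : ∀ u : EnergySpace Ω, ‖u.toLp‖ ^ 2 ≤ C * ‖u‖ ^ 2)
    (u v : EnergySpace Ω) : massDeriv h u v = 2 * inner ℝ u.toLp v.toLp := rfl

lemma toLp_sub_add (u v : EnergySpace Ω) : u.toLp + (v - u).toLp = v.toLp :=
  add_sub_cancel u.toLp v.toLp

lemma hasFDerivAt_massI {C : ℝ} (h : ∀ u : EnergySpace Ω, ‖u.toLp‖ ^ 2 ≤ C * ‖u‖ ^ 2)
    (u : EnergySpace Ω) : HasFDerivAt massI (massDeriv h u) u := by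
  refine hasFDerivAt_of_quadratic_remainder (C := C) fun v => ?_
  rw [massDeriv_apply, EnergySpace.massI_eq, EnergySpace.massI_eq, ← toLp_sub_add u v,
    norm_add_sq_real, show ‖u.toLp‖ ^ 2 + 2 * inner ℝ u.toLp (v - u).toLp + ‖(v - u).toLp‖ ^ 2
      - ‖u.toLp‖ ^ 2 - 2 * inner ℝ u.toLp (v - u).toLp = ‖(v - u).toLp‖ ^ 2 by ring,
    abs_of_nonneg (sq_nonneg _)]
  exact h _

lemma abs_sq_posPart_sub_le (a b : ℝ) (ha : 0 ≤ a) :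
    |max b 0 ^ 2 - a ^ 2 - 2 * (a * (b - a))| ≤ (b - a) ^ 2 := by
  rcases le_total 0 b with hb | hb
  · rw [max_eq_left hb, abs_le]
    constructor <;> nlinarith [sq_nonneg (b - a)]
  · rw [max_eq_right hb, abs_le]
    constructor <;> nlinarith [mul_nonneg ha (neg_nonneg.2 hb), sq_nonneg a, sq_nonneg b]

lemma EnergySpace.integrable_posPart_sq (u : EnergySpace Ω) :
    Integrable fun x => max (u x) 0 ^ 2 := by
  refine u.integrable_sq.mono'
    ((u.measurable.max measurable_const).pow_const 2).aestronglyMeasurable (Filter.Eventually.of_forall fun x => ?_)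
  rw [Real.norm_of_nonneg (sq_nonneg _)]
  rcases le_total 0 (u x) with h | h
  · rw [max_eq_left h]
  · rw [max_eq_right h]
    nlinarith [sq_nonneg (u x)]

lemma setIntegral_posPart_sq_le (u : EnergySpace Ω) :
    ∫ x in Ω, max (u x) 0 ^ 2 ≤ massI u := by
  refine integral_mono u.integrable_posPart_sq.integrableOn u.integrable_sq.integrableOn fun x => ?_
  simp only
  rcases le_total 0 (u x) with h | h
  · rw [max_eq_left h]
  · rw [max_eq_right h]
    nlinarith [sq_nonneg (u x)]

lemma abs_setIntegral_posPart_sq_sub_le {φ : EnergySpace Ω} (hφ : ∀ᵐ x, 0 ≤ φ x)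
    (v : EnergySpace Ω) :
    |(∫ x in Ω, max (v x) 0 ^ 2) - (∫ x in Ω, max (φ x) 0 ^ 2)
      - 2 * inner ℝ φ.toLp (v - φ).toLp| ≤ ‖(v - φ).toLp‖ ^ 2 := by
  have h1 := v.integrable_posPart_sq.integrableOn (s := Ω)
  have h2 := φ.integrable_posPart_sq.integrableOn (s := Ω)
  have h3 := (φ.integrable_mul (v - φ)).integrableOn (s := Ω)
  have h12 : IntegrableOn (fun x => max (v x) 0 ^ 2 - max (φ x) 0 ^ 2) Ω := h1.sub h2
  rw [EnergySpace.inner_toLp, ← EnergySpace.setIntegral_mul_eq, ← EnergySpace.massI_eq,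
    ← integral_const_mul, ← integral_sub h1 h2, ← integral_sub h12 (h3.const_mul 2)]
  refine abs_integral_le_integral_abs.trans (integral_mono_ae
    (h12.sub (h3.const_mul 2)).abs (v - φ).integrable_sq.integrableOn ?_)
  filter_upwards [ae_restrict_of_ae hφ, ae_restrict_of_ae (v.coe_sub φ)] with x hx hs
  rw [hs, max_eq_left hx]
  exact abs_sq_posPart_sub_le _ _ hx

namespace IsFirstEigenfunction

variable {φ : EnergySpace Ω}

lemma formL_eq_inner (hφ : IsFirstEigenfunction φ) (v : EnergySpace Ω) :
    formL φ v = firstEigenvalue Ω * inner ℝ φ.toLp v.toLp := by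
  rw [hφ.eigen, EnergySpace.setIntegral_mul_eq, EnergySpace.inner_toLp]

lemma setIntegral_posPart_mul (hφ : IsFirstEigenfunction φ) (f : Space N → ℝ) :
    ∫ x in Ω, max (φ x) 0 * f x = ∫ x in Ω, φ x * f x := by
  refine integral_congr_ae ?_
  filter_upwards [ae_restrict_of_ae hφ.nonneg] with x hx
  rw [max_eq_left hx]

lemma setIntegral_negPart_mul (hφ : IsFirstEigenfunction φ) (f : Space N → ℝ) :
    ∫ x in Ω, max (-φ x) 0 * f x = 0 := by
  refine integral_eq_zero_of_ae ?_
  filter_upwards [ae_restrict_of_ae hφ.nonneg] with x hx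
  rw [max_eq_right (neg_nonpos.2 hx), zero_mul, Pi.zero_apply]

lemma energy_eq (hφ : IsFirstEigenfunction φ) (r : ℝ) :
    energy r φ = firstEigenvalue Ω - r := by
  have h1 := (mem_unitSphere_iff φ).1 hφ.mem_unitSphere
  have h2 : ∫ x in Ω, max (φ x) 0 ^ 2 = 1 := by
    rw [← hφ.mem_unitSphere, massI]
    refine integral_congr_ae ?_
    filter_upwards [ae_restrict_of_ae hφ.nonneg] with x hx
    rw [max_eq_left hx]
  rw [energy, h2, hφ.formL_eq_inner, real_inner_self_eq_norm_sq, h1]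
  ring

lemma isMinOn_energy (hφ : IsFirstEigenfunction φ) (hΩ : Bornology.IsBounded Ω)
    (hm : MeasurableSet Ω) {r : ℝ} (hr : 0 ≤ r) : IsMinOn (energy r) (unitSphere Ω) φ := by
  refine isMinOn_iff.2 fun u hu => ?_
  rw [hφ.energy_eq, energy]
  have h1 := firstEigenvalue_le hΩ hm hu
  have h2 := setIntegral_posPart_sq_le u
  rw [show massI u = 1 from hu] at h2
  nlinarith

lemma mem_fucikSpectrum (hφ : IsFirstEigenfunction φ) (β : ℝ) :
    (firstEigenvalue Ω, β) ∈ fucikSpectrum Ω := by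
  refine ⟨φ, ?_, fun v => ?_⟩
  · rintro rfl
    have h := (mem_unitSphere_iff (0 : EnergySpace Ω)).1 hφ.mem_unitSphere
    rw [show (0 : EnergySpace Ω).toLp = 0 from rfl, norm_zero] at h
    norm_num at h
  · rw [hφ.setIntegral_posPart_mul, hφ.setIntegral_negPart_mul, mul_zero, sub_zero, hφ.eigen]

lemma isCriticalPoint (hφ : IsFirstEigenfunction φ) (hN : 1 ≤ N) (hΩ : Bornology.IsBounded Ω)
    (hm : MeasurableSet Ω) (r : ℝ) : IsCriticalPoint r φ := by
  obtain ⟨C, hC, hP⟩ := exists_poincare (Ω := Ω) hN hΩ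
  refine ⟨hφ.mem_unitSphere, firstEigenvalue Ω - r, (firstEigenvalue Ω - r) • massDeriv hP φ,
    massDeriv hP φ, ?_, hasFDerivAt_massI hP φ, rfl⟩
  refine hasFDerivAt_of_quadratic_remainder
    (C := 1 + |lowerOrderBound Ω| * C + |r| * C) fun v => ?_
  set w := v - φ with hw
  have h1 : formL v v = formL φ φ + 2 * formL φ w + formL w w := by
    rw [show v = w + φ from (sub_add_cancel v φ).symm, formL_add_left hΩ hm, formL_comm w,
      formL_comm φ (w + φ), formL_add_left hΩ hm, formL_add_left hΩ hm, formL_comm w φ]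
    ring
  have h2 : energy r v - energy r φ - ((firstEigenvalue Ω - r) • massDeriv hP φ) w =
      ‖w‖ ^ 2 + (formL w w - inner ℝ w w) - r * ((∫ x in Ω, max (v x) 0 ^ 2)
        - (∫ x in Ω, max (φ x) 0 ^ 2) - 2 * inner ℝ φ.toLp w.toLp) := by
    rw [smul_apply, massDeriv_apply, smul_eq_mul, energy, energy, h1,
      hφ.formL_eq_inner w, real_inner_self_eq_norm_sq]
    ring
  have h3 := abs_formL_sub_le hΩ hm w w
  have h4 := abs_setIntegral_posPart_sq_sub_le hφ.nonneg v
  rw [← hw] at h4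
  have h5 := hP w
  rw [h2]
  refine (abs_sub _ _).trans ?_
  rw [abs_mul, add_mul, add_mul, one_mul]
  refine add_le_add ((abs_add_le _ _).trans (add_le_add (abs_of_nonneg (sq_nonneg _)).le ?_)) ?_
  · rw [← sq] at h3
    refine h3.trans ((mul_le_mul_of_nonneg_right (le_abs_self _) (sq_nonneg _)).trans ?_)
    rw [mul_assoc]
    exact mul_le_mul_of_nonneg_left h5 (abs_nonneg _)
  · rw [mul_assoc]
    exact mul_le_mul_of_nonneg_left (h4.trans h5) (abs_nonneg _)

end IsFirstEigenfunction

end CriticalPoint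

end LogLaplacian

end

theorem mainTheorem10 (N : ℕ) (hN : 1 ≤ N) (Ω : Set (EuclideanSpace ℝ (Fin N)))
    (hΩ_open : IsOpen Ω) (hΩ_bdd : Bornology.IsBounded Ω) (hΩ_ne : Ω.Nonempty) :
    (∃ φ : LogLaplacian.EnergySpace Ω, LogLaplacian.IsFirstEigenfunction φ) ∧
    (∀ φ : LogLaplacian.EnergySpace Ω, LogLaplacian.IsFirstEigenfunction φ →
      ∀ r : ℝ, 0 ≤ r →
        LogLaplacian.IsCriticalPoint r φ ∧
        IsMinOn (LogLaplacian.energy r) (LogLaplacian.unitSphere Ω) φ ∧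
        LogLaplacian.energy r φ = LogLaplacian.firstEigenvalue Ω - r ∧
        (LogLaplacian.firstEigenvalue Ω, LogLaplacian.firstEigenvalue Ω - r) ∈
          LogLaplacian.fucikSpectrum Ω) ∧
    (∀ β : ℝ, (LogLaplacian.firstEigenvalue Ω, β) ∈ LogLaplacian.fucikSpectrum Ω) := by
  obtain ⟨φ₁, hφ₁⟩ := LogLaplacian.exists_isFirstEigenfunction hN hΩ_open hΩ_bdd hΩ_ne
  have hm := hΩ_open.measurableSet
  exact ⟨⟨φ₁, hφ₁⟩, fun φ hφ r hr => ⟨hφ.isCriticalPoint hN hΩ_bdd hm r,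
    hφ.isMinOn_energy hΩ_bdd hm hr, hφ.energy_eq r, hφ.mem_fucikSpectrum _⟩,
    hφ₁.mem_fucikSpectrum⟩
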